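/- Let $k$ be a field and $K$ an algebraically closed extension field of $k$. An algebra means a nonassociative algebra (a vector space with a bilinear multiplication subject to no further conditions); it is simple if its multiplication is nonzero and it has no two-sided ideals other than zero and itself. A linear algebraic $k$-group is a linear algebraic group over $K$ (an affine variety over $K$ with a compatible group structure) that is defined over $k$. For a finite-dimensional $k$-algebra $A$ put $A_K=A\otimes_k K$; the group $\operatorname{Aut}(A_K)$ of all $K$-algebra automorphisms of $A_K$ is a subgroup of $\operatorname{GL}(A_K)$, and $\operatorname{GL}(A_K)$ carries the $k$-structure given by the $k$-form $A$ of $A_K$. A closed subgroup of $\operatorname{GL}(V\otimes_k K)$, for a finite-dimensional $k$-vector space $V$, is called defined over $k$ if its vanishing ideal is generated by regular functions with coefficients in $k$. **Theorem 1.** If $k$ contains sufficiently many elements (for instance, if $k$ is infinite), then for each linear algebraic $k$-group $G$ there is a finite-dimensional simple algebra $A$ over $k$ such that $\operatorname{Aut}(A_K)$ is a closed subgroup of $\operatorname{GL}(A_K)$ that is defined over $k$ and $k$-isomorphic to $G$. Moreover, $A$ can be chosen absolutely simple, that is, such that $A\otimes_k F$ is a simple $F$-algebra for each field extension $F/k$.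 Here "sufficiently many" has the following meaning. Every linear algebraic $k$-group $G$ is $k$-isomorphic, for some $m,h\ge 0$, to a closed subgroup of $\operatorname{GL}_m(K)$ whose vanishing ideal in $K[\operatorname{GL}_m]$ is generated by polynomials of degree at most $h$ in the matrix entries with coefficients in $k$. There is a function $N:\mathbb{N}\times\mathbb{N}\to\mathbb{N}$, independent of $k$, $K$ and $G$, such that the assertion holds for $G$ whenever $k$ is infinite, or $|k|\ge N(m,h)$ for some such pair $(m,h)$. -/

import Mathlib

open scoped TensorProduct

universe u v w x

noncomputable section

/-! ### Affine varieties over `K` with a `k`-structure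

`K` is an algebraically closed extension of `k`. An affine `k`-variety is a set `X` of points
together with the `k`-algebra `R = k[X]` of `K`-valued functions on `X` that are regular and
defined over `k`. -/

/-- `R = k[X]` makes the set `X` an affine algebraic variety over `K` endowed with a
`k`-structure. The algebra of regular functions `K[X]` is the `K`-span of `R`. -/
structure IsAffineVariety (k : Type*) [Field k] {K : Type*} [Field K] [Algebra k K]
    {X : Type*} (R : Subalgebra k (X → K)) : Prop where
  /-- `k[X]` is a finitely generated `k`-algebra. -/
  fg : R.FG
  /-- `k[X]` is a `k`-structure on `K[X]`, i.e. `K ⊗ k[X] = K[X]`: families that are linearly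
  independent over `k` remain so over `K`. -/
  linearIndep : ∀ s : Set (X → K), s ⊆ (R : Set (X → K)) →
    LinearIndepOn k id s → LinearIndepOn K id s
  /-- The points of `X` are the `K`-algebra homomorphisms `K[X] → K`, which are the
  `k`-algebra homomorphisms `k[X] → K`. -/
  points : Function.Bijective
    (fun x : X => (((Pi.evalAlgHom k (fun _ : X => K) x).comp R.val : R →ₐ[k] K)))

/-- `R = k[G]` makes the group `G` a linear algebraic `k`-group: `G` is an affine `k`-variety,
multiplication and inversion are morphisms defined over `k`, and the identity is `k`-rational. -/
structure IsLinearAlgebraicGroup (k : Type*) [Field k] {K : Type*} [Field K] [Algebra k K]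
    {G : Type*} [Group G] (R : Subalgebra k (G → K)) : Prop extends IsAffineVariety k R where
  /-- The comultiplication maps `k[G]` to `k[G × G] = k[G] ⊗ k[G]`. -/
  mul_regular : ∀ f ∈ R, (fun p : G × G => f (p.1 * p.2)) ∈
    Submodule.span k {F : G × G → K | ∃ a ∈ R, ∃ b ∈ R, F = fun p => a p.1 * b p.2}
  inv_regular : ∀ f ∈ R, (fun x : G => f x⁻¹) ∈ R
  one_rational : ∀ f ∈ R, ∃ c : k, f 1 = algebraMap k K c

/-- The groups `G` and `G'` with `k`-structures `R = k[G]` and `R' = k[G']` are `k`-isomorphic: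
there is a group isomorphism that is an isomorphism of varieties defined over `k`. -/
def IsKIsomorphic (k : Type*) [Field k] {K : Type*} [Field K] [Algebra k K]
    {G G' : Type*} [Group G] [Group G']
    (R : Subalgebra k (G → K)) (R' : Subalgebra k (G' → K)) : Prop :=
  ∃ φ : G ≃* G', ∀ f : G' → K, f ∈ R' ↔ (fun x => f (φ x)) ∈ R

/-! ### Closed subvarieties and fields of definition -/

section Subvarieties

variable {k : Type*} [Field k] {K : Type*} [Field K] [Algebra k K] {X : Type*}

/-- The `K`-algebra `K[X]` of regular functions generated by `R = k[X]`. -/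
def regularFunctions (R : Subalgebra k (X → K)) : Subalgebra K (X → K) :=
  Algebra.adjoin K (R : Set (X → K))

/-- The ideal of `K[X]` of all regular functions that vanish on `H`. -/
def vanishingIdeal (R : Subalgebra k (X → K)) (H : Set X) : Ideal (regularFunctions R) where
  carrier := {f | ∀ x ∈ H, (f : X → K) x = 0}
  add_mem' := by
    intro a b ha hb x hx
    simp [ha x hx, hb x hx]
  zero_mem' := by
    intro x _
    simp
  smul_mem' := by
    intro c a ha x hx
    simp [ha x hx]

/-- `H` is Zariski closed in `X`. -/
def IsZariskiClosed (R : Subalgebra k (X → K)) (H : Set X) : Prop :=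
  ∀ x : X, (∀ f ∈ vanishingIdeal R H, (f : X → K) x = 0) → x ∈ H

/-- `H` is a closed subvariety of `X` defined over `k`: its ideal in `K[X]` is generated by
elements of `k[X]`. -/
def IsDefinedOver (R : Subalgebra k (X → K)) (H : Set X) : Prop :=
  IsZariskiClosed R H ∧
    vanishingIdeal R H = Ideal.span {f | f ∈ vanishingIdeal R H ∧ (f : X → K) ∈ R}

/-- The restrictions to `H` of the elements of `R = k[X]`. If `H` is defined over `k`, this is
the `k`-structure `k[H]` of `H`. -/
def restrictRegular (R : Subalgebra k (X → K)) (H : Set X) : Subalgebra k (H → K) :=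
  R.map (AlgHom.pi (fun x : H => Pi.evalAlgHom k (fun _ : X => K) (x : X)))

end Subvarieties

/-! ### The group `GL(V_K)` -/

section GeneralLinear

variable (k : Type*) [Field k] (K : Type*) [Field K] [Algebra k K]
  (V : Type*) [AddCommGroup V] [Module k V]

/-- The `k`-span of the constant `1` and of the matrix coefficients `g ↦ ⟨l, g v⟩` on `GL(V_K)`,
where `v ∈ V` and `l ∈ V*`. -/
def matrixCoeffs : Submodule k (((K ⊗[k] V) ≃ₗ[K] (K ⊗[k] V)) → K) :=
  Submodule.span k ({1} ∪ {f | ∃ (v : V) (l : Module.Dual k V),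
    f = fun g => Module.Dual.baseChange K l (g (1 ⊗ₜ[k] v))})

/-- The `k`-structure `k[GL(V)]` on `GL(V_K)` for a finite-dimensional space `V` over `k`: the
`k`-algebra generated by the matrix coefficients and the inverse of the determinant. -/
def glRegular : Subalgebra k (((K ⊗[k] V) ≃ₗ[K] (K ⊗[k] V)) → K) :=
  Algebra.adjoin k ((matrixCoeffs k K V : Set (((K ⊗[k] V) ≃ₗ[K] (K ⊗[k] V)) → K)) ∪
    {fun g => (((LinearEquiv.det g)⁻¹ : Kˣ) : K)})

/-- `H ⊆ GL(V_K)` is a closed subset whose ideal in `K[GL(V_K)]` is generated by polynomials of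
degree at most `h` in the matrix coefficients, with coefficients in `k`. -/
def IsDefinedInDegree (h : ℕ) (H : Set ((K ⊗[k] V) ≃ₗ[K] (K ⊗[k] V))) : Prop :=
  IsZariskiClosed (glRegular k K V) H ∧
    vanishingIdeal (glRegular k K V) H =
      Ideal.span {f | f ∈ vanishingIdeal (glRegular k K V) H ∧
        (f : ((K ⊗[k] V) ≃ₗ[K] (K ⊗[k] V)) → K) ∈ matrixCoeffs k K V ^ h}

end GeneralLinear

/-- The group with `k`-structure `R` is `k`-isomorphic to a closed subgroup of `GL_m(K)` whose
ideal is generated by polynomials over `k` of degree at most `h` in the matrix entries. -/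
def HasLinearRealization (k : Type*) [Field k] {K : Type*} [Field K] [Algebra k K]
    {G : Type*} [Group G] (R : Subalgebra k (G → K)) (m h : ℕ) : Prop :=
  ∃ H : Subgroup ((K ⊗[k] (Fin m → k)) ≃ₗ[K] (K ⊗[k] (Fin m → k))),
    IsDefinedInDegree k K (Fin m → k) h (H : Set _) ∧
    IsKIsomorphic k R (restrictRegular (glRegular k K (Fin m → k)) (H : Set _) :
      Subalgebra k (H → K))

/-! ### Nonassociative algebras -/

/-- A nonassociative algebra over a field is simple if its multiplication is nonzero and it has
no two-sided ideals except zero and itself. -/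
def IsSimpleAlgebra (F : Type*) [Field F] (A : Type*) [NonUnitalNonAssocRing A] [Module F A] :
    Prop :=
  (∃ x y : A, x * y ≠ 0) ∧
    ∀ I : Submodule F A, (∀ a ∈ I, ∀ x : A, x * a ∈ I ∧ a * x ∈ I) → I = ⊥ ∨ I = ⊤

instance tensorNonUnitalNonAssocRing (k F A : Type*) [Field k] [Field F] [Algebra k F]
    [NonUnitalNonAssocRing A] [Module k A] [SMulCommClass k A A] [IsScalarTower k A A] :
    NonUnitalNonAssocRing (F ⊗[k] A) :=
  { (inferInstance : NonUnitalNonAssocSemiring (F ⊗[k] A)),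
    (inferInstance : AddCommGroup (F ⊗[k] A)) with }

/-- The full automorphism group `Aut(A_K)` of the `K`-algebra `A_K`, as a subgroup of
`GL(A_K)`. -/
def autGroup (k K A : Type*) [Field k] [Field K] [Algebra k K]
    [NonUnitalNonAssocRing A] [Module k A] [SMulCommClass k A A] [IsScalarTower k A A] :
    Subgroup ((K ⊗[k] A) ≃ₗ[K] (K ⊗[k] A)) where
  carrier := {g | ∀ x y, g (x * y) = g x * g y}
  mul_mem' := by
    intro a b ha hb x y
    exact (congrArg a (hb x y)).trans (ha (b x) (b y))
  one_mem' := by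
    intro x y
    rfl
  inv_mem' := by
    intro a ha x y
    apply a.injective
    have key : ∀ z, a (a⁻¹ z) = z := fun z => a.apply_symm_apply z
    rw [key, ha (a⁻¹ x) (a⁻¹ y), key, key]

end

/-! Realize `G` in some `GL_m` by equations over `k` of degree at most `n`, with `n ≥ 1`, and let
`M` be the space of functions on `G` that are polynomials of degree at most `n` in the matrix
entries. It is finite-dimensional, contains 1, and is mapped into `M ⊗ M` by the comultiplication.
Over `K`, right translations are exactly the injective linear maps `g` of `M` that fix 1, commute
with left translations, and respect every relation `m₁ m₂ = m₃` inside `M`. Indeed, commuting with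
left translations forces `g` to multiply each row of matrix coefficients by one matrix `γ`, which is
invertible by injectivity (`exists_matrix_of_commute`). Then `f ↦ g(f)(1)` is evaluation at `γ` on
polynomials of degree at most `n`, so the equations of `G` hold at `γ`, and `g` is translation by `γ
∈ G` (`exists_translation`).

The algebra encodes these data. Its space is the sum of a line spanned by `e`, of `M`, `M*`, `N =
(M·M)*`, and of a space `C` with basis `c_i` indexed by a basis `b_i` of `M`. The element `e` is a
left identity, and right multiplication by `e` is diagonal, with distinct nonzero eigenvalues on the
first four summands and on the lines of the `c_i`. The other products are the pairing `M × M* →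
⟨e⟩`, the map `M × N → M*` dual to multiplication of functions, the product `m c_j` equal to the
coefficient of `b_j(x)` in `m(xy)`, and `c_i c_j = δ_ij (e + 1_M + c_i)`.

Simplicity (`eq_bot_or_eq_top_of_ideal`): polynomials in right multiplication by `e` extract the
`e`-coordinate, and nondegeneracy makes some element of any nonzero ideal have a nonzero one. The
argument survives every field extension. An automorphism fixes `e`, hence preserves the eigenspaces;
the squares `c_i²` force it to fix all `c_i` and `1_M` (`aut_op_single`). So its restriction to `M`
has the three properties above (`aut_act`, `aut_trilinear_congr`), and this restriction determines
it (`aut_eq_refl`). Hence the automorphism group is the image of `G`.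

This image is closed and defined over `k` because `k[GL]` pulls back onto `k[G]`
(`isDefinedOver_range`). The size of `k` matters only for the `dim M + 4` distinct nonzero
eigenvalues. -/

/-! ### Closed immersions defined over `k`. -/

section Extension

variable {k : Type*} [Field k] {K : Type*} [Field K] [Algebra k K] {X : Type*}

/-- If linear independence over `k` in `R` implies linear independence over `K`, then every
`k`-linear map from `R` to a `K`-vector space extends to a `K`-linear map. -/
theorem exists_linear_extension {R : Submodule k (X → K)}
    (hR : ∀ s : Set (X → K), s ⊆ (R : Set (X → K)) → LinearIndepOn k id s → LinearIndepOn K id s)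
    {W : Type*} [AddCommGroup W] [Module K W] [Module k W] [IsScalarTower k K W]
    (σ : R →ₗ[k] W) : ∃ s : (X → K) →ₗ[K] W, ∀ r : R, s r = σ r := by
  let B := Module.Basis.ofVectorSpace k R
  have hk : LinearIndependent k (fun i => (B i : X → K)) :=
    B.linearIndependent.map' R.subtype (Submodule.ker_subtype R)
  have hK : LinearIndependent K (fun i => (B i : X → K)) := by
    have h1 : LinearIndepOn k id (Set.range (fun i => (B i : X → K))) := hk.linearIndepOn_id
    have h2 := hR _ (by rintro _ ⟨i, rfl⟩; exact (B i).2) h1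
    exact LinearIndependent.of_linearIndepOn_id_range hk.injective h2
  let C := Module.Basis.span hK
  obtain ⟨s, hs⟩ := LinearMap.exists_extend (C.constr K (fun i => σ (B i)))
  refine ⟨s, ?_⟩
  have hB : ∀ i, s (B i) = σ (B i) := by
    intro i
    have h1 := LinearMap.congr_fun hs (C i)
    rw [Module.Basis.constr_basis] at h1
    rw [← h1]
    simp [C, Module.Basis.span_apply]
  have : (s.restrictScalars k).comp R.subtype = σ := B.ext fun i => hB i
  intro r
  exact LinearMap.congr_fun this r

theorem linearIndependent_of_mem {R : Submodule k (X → K)}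
    (hR : ∀ s : Set (X → K), s ⊆ (R : Set (X → K)) → LinearIndepOn k id s → LinearIndepOn K id s)
    {ι : Type*} {v : ι → X → K} (hv : ∀ i, v i ∈ R) (h : LinearIndependent k v) :
    LinearIndependent K v :=
  LinearIndependent.of_linearIndepOn_id_range h.injective
    (hR _ (by rintro _ ⟨i, rfl⟩; exact hv i) h.linearIndepOn_id)

/-- `R` is closed under products, so its `K`-span is already an algebra. -/
theorem mem_regularFunctions_iff {R : Subalgebra k (X → K)} {f : X → K} :
    f ∈ regularFunctions R ↔ f ∈ Submodule.span K (R : Set (X → K)) := by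
  rw [regularFunctions, ← Subalgebra.mem_toSubmodule, Algebra.adjoin_eq_span]
  have : Submonoid.closure (R : Set (X → K)) = R.toSubmonoid := Submonoid.closure_eq R.toSubmonoid
  rw [this]
  rfl

/-- A map of `X` to `Y` along which `R` is the pullback of `S` is a closed immersion
defined over `k`. -/
theorem isDefinedOver_range {R : Subalgebra k (X → K)} (hR : IsAffineVariety k R)
    {Y : Type*} {S : Subalgebra k (Y → K)}
    (hsep : ∀ y y' : Y, (∀ F ∈ S, F y = F y') → y = y') (Φ : X → Y)
    (hS : ∀ F ∈ S, F ∘ Φ ∈ R) (hRS : ∀ f ∈ R, ∃ F ∈ S, F ∘ Φ = f) :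
    IsDefinedOver S (Set.range Φ) := by
  let P : (Y → K) →ₗ[K] (X → K) := LinearMap.funLeft K K Φ
  let π : S.toSubmodule →ₗ[k] R.toSubmodule :=
    (P.restrictScalars k).restrict (fun F hF => hS F hF)
  have hπ : LinearMap.range π = ⊤ := by
    rw [LinearMap.range_eq_top]
    rintro ⟨f, hf⟩
    obtain ⟨F, hF, rfl⟩ := hRS f hf
    exact ⟨⟨F, hF⟩, rfl⟩
  obtain ⟨σ, hσ⟩ := π.exists_rightInverse_of_surjective hπ
  have hσ' : ∀ r : R.toSubmodule, ((σ r : Y → K)) ∘ Φ = r := fun r =>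
    congrArg Subtype.val (LinearMap.congr_fun hσ r)
  constructor
  · intro y hy
    have key : ∀ F ∈ S, F ∘ Φ = 0 → F y = 0 := by
      intro F hF h0
      refine hy ⟨F, Algebra.subset_adjoin hF⟩ ?_
      rintro _ ⟨x, rfl⟩
      exact congrFun h0 x
    have key2 : ∀ F ∈ S, ∀ F' ∈ S, F ∘ Φ = F' ∘ Φ → F y = F' y := by
      intro F hF F' hF' h
      refine sub_eq_zero.1 (key (F - F') (sub_mem hF hF') ?_)
      funext x
      exact sub_eq_zero.2 (congrFun h x)
    -- The section `σ` is only linear, but evaluation at `y` does not depend on the chosen lift, so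
    -- the composite is multiplicative and hence a point of `X`.
    let χ : R →ₐ[k] K := AlgHom.ofLinearMap
      ((LinearMap.proj y : (Y → K) →ₗ[k] K) ∘ₗ S.toSubmodule.subtype ∘ₗ σ)
      (key2 _ (σ _).2 1 (one_mem S) (hσ' _))
      (fun a b => key2 _ (σ _).2 (σ a * σ b) (mul_mem (σ a).2 (σ b).2) (by
        refine (hσ' _).trans ?_
        funext x
        exact (congrArg₂ (· * ·) (congrFun (hσ' a) x) (congrFun (hσ' b) x)).symm))
    obtain ⟨x, hx⟩ := hR.points.2 χ
    refine ⟨x, hsep _ _ fun F hF => ?_⟩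
    have h1 : F (Φ x) = χ ⟨F ∘ Φ, hS F hF⟩ := by
      rw [← hx]; rfl
    rw [h1]
    exact key2 _ (σ _).2 _ hF (hσ' _)
  · apply le_antisymm
    · let Z : Set (Y → K) := {F | F ∈ S ∧ F ∘ Φ = 0}
      -- With `σ` extended `K`-linearly, `F ↦ F - s (F ∘ Φ)` fixes the functions vanishing on the
      -- image and maps `S` into the elements of `S` vanishing there.
      obtain ⟨s, hs⟩ := exists_linear_extension (R := R.toSubmodule) hR.linearIndep
        (S.toSubmodule.subtype ∘ₗ σ)
      have h1 : ∀ F ∈ Submodule.span K (S : Set (Y → K)), F - s (P F) ∈ Submodule.span K Z := by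
        intro F hF
        induction hF using Submodule.span_induction with
        | mem F hF =>
          refine Submodule.subset_span ?_
          have h2 : s (P F) = σ ⟨F ∘ Φ, hS F hF⟩ := hs ⟨F ∘ Φ, hS F hF⟩
          rw [h2]
          refine ⟨sub_mem hF (σ _).2, ?_⟩
          funext x
          have := congrFun (hσ' ⟨F ∘ Φ, hS F hF⟩) x
          simpa [sub_eq_zero] using this.symm
        | zero => simp
        | add a b _ _ ha hb =>
          have : a + b - s (P (a + b)) = (a - s (P a)) + (b - s (P b)) := by
            rw [map_add, map_add]; abel
          rw [this]; exact add_mem ha hb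
        | smul c a _ ha =>
          rw [map_smul, map_smul, ← smul_sub]
          exact Submodule.smul_mem _ c ha
      have h2 : ∀ F ∈ Submodule.span K Z, ∃ hF : F ∈ regularFunctions S,
          (⟨F, hF⟩ : regularFunctions S) ∈
            Ideal.span {f | f ∈ vanishingIdeal S (Set.range Φ) ∧ (f : Y → K) ∈ S} := by
        intro F hF
        induction hF using Submodule.span_induction with
        | mem F hF =>
          refine ⟨Algebra.subset_adjoin hF.1, Ideal.subset_span ⟨?_, hF.1⟩⟩
          rintro _ ⟨x, rfl⟩
          exact congrFun hF.2 x
        | zero => exact ⟨zero_mem _, zero_mem (Ideal.span _)⟩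
        | add a b _ _ ha hb =>
          obtain ⟨ha, ha'⟩ := ha
          obtain ⟨hb, hb'⟩ := hb
          exact ⟨add_mem ha hb, add_mem ha' hb'⟩
        | smul c a _ ha =>
          obtain ⟨ha, ha'⟩ := ha
          refine ⟨Subalgebra.smul_mem _ ha c, ?_⟩
          have := Ideal.mul_mem_left _ (algebraMap K (regularFunctions S) c) ha'
          rwa [← Algebra.smul_def] at this
      rintro ⟨f, hf⟩ hfv
      have h3 : P f = 0 := funext fun x => hfv (Φ x) ⟨x, rfl⟩
      have h4 := h1 f (mem_regularFunctions_iff.1 hf)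
      rw [h3, map_zero, sub_zero] at h4
      exact (h2 f h4).2
    · rw [Ideal.span_le]
      exact fun f hf => hf.1

end Extension

section ClosedSubgroup

variable {k : Type*} [Field k] {K : Type*} [Field K] [Algebra k K] {G G' : Type*} [Group G]
  [Group G'] {R : Subalgebra k (G → K)} {S : Subalgebra k (G' → K)}

/-- `Φ` is injective because `k[G]` separates points and each of its elements factors through `Φ`.
-/
theorem isKIsomorphic_range (hR : IsAffineVariety k R)
    (Φ : G →* G') (hS : ∀ F ∈ S, F ∘ Φ ∈ R) (hRS : ∀ f ∈ R, ∃ F ∈ S, F ∘ Φ = f)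
    (H : Subgroup G') (hH : Φ.range = H) :
    IsKIsomorphic k R (restrictRegular S (H : Set G') : Subalgebra k (H → K)) := by
  subst hH
  have hinj : Function.Injective Φ := by
    intro x y hxy
    refine hR.points.1 ?_
    ext ⟨f, hf⟩
    obtain ⟨F, -, rfl⟩ := hRS f hf
    change F (Φ x) = F (Φ y)
    rw [hxy]
  refine ⟨MonoidHom.ofInjective hinj, fun f => ⟨?_, ?_⟩⟩
  · rintro ⟨F, hF, rfl⟩
    exact hS F hF
  · intro hf
    obtain ⟨F, hF, hFf⟩ := hRS _ hf
    refine ⟨F, hF, ?_⟩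
    funext y
    obtain ⟨x, rfl⟩ := (MonoidHom.ofInjective hinj).surjective y
    exact congrFun hFf x

end ClosedSubgroup

/-! ### Regular functions on `GL(V_K)` and representations in coordinates. -/

section GLCoefficients

variable {k : Type*} [Field k] {K : Type*} [Field K] [Algebra k K]
  {V : Type*} [AddCommGroup V] [Module k V]

/-- The matrix coefficient `g ↦ ⟨l, g v⟩` on `GL(V_K)`. -/
def matrixCoeff (K : Type*) [Field K] [Algebra k K] (v : V) (l : Module.Dual k V) :
    ((K ⊗[k] V) ≃ₗ[K] (K ⊗[k] V)) → K :=
  fun g => Module.Dual.baseChange K l (g (1 ⊗ₜ[k] v))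

theorem matrixCoeff_mem_matrixCoeffs (v : V) (l : Module.Dual k V) :
    matrixCoeff K v l ∈ matrixCoeffs k K V :=
  Submodule.subset_span (Or.inr ⟨v, l, rfl⟩)

theorem matrixCoeff_mem_glRegular (v : V) (l : Module.Dual k V) :
    matrixCoeff K v l ∈ glRegular k K V :=
  Algebra.subset_adjoin (Or.inl (matrixCoeff_mem_matrixCoeffs v l))

theorem baseChange_repr_eq {ι : Type*} (B : Module.Basis ι k V) (i : ι) (z : K ⊗[k] V) :
    (B.baseChange K).repr z i = Module.Dual.baseChange K (B.coord i) z := by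
  induction z using TensorProduct.induction_on with
  | zero => simp
  | tmul a v => simp [Module.Dual.baseChange, Algebra.smul_def, mul_comm]
  | add a b ha hb => simp [ha, hb]

theorem glRegular_separates (g g' : (K ⊗[k] V) ≃ₗ[K] (K ⊗[k] V))
    (h : ∀ F ∈ glRegular k K V, F g = F g') : g = g' := by
  let B := Module.Basis.ofVectorSpace k V
  apply LinearEquiv.toLinearMap_injective
  refine (B.baseChange K).ext fun j => (B.baseChange K).ext_elem fun i => ?_
  rw [baseChange_repr_eq, baseChange_repr_eq, Module.Basis.baseChange_apply]
  exact h _ (matrixCoeff_mem_glRegular (B j) (B.coord i))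

theorem det_mem_of_entries_mem {X n : Type*} [Fintype n] [DecidableEq n]
    {R : Subalgebra k (X → K)} {f : n → n → X → K} (hf : ∀ i j, f i j ∈ R) :
    (fun x => (Matrix.of fun i j => f i j x).det) ∈ R := by
  have h : (fun x => (Matrix.of fun i j => f i j x).det) = (Matrix.of f).det := by
    funext x
    exact ((Pi.evalRingHom (fun _ : X => K) x).map_det (Matrix.of f)).symm
  rw [h, Matrix.det_apply]
  refine sum_mem fun p _ => ?_
  rw [Units.smul_def]
  exact zsmul_mem (prod_mem fun i _ => hf _ _) _

variable {G : Type*} [Group G] {R : Subalgebra k (G → K)}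

/-- The only generator that is not a matrix coefficient is the inverse determinant; at `Φ x` it
equals the determinant of `Φ x⁻¹`, a polynomial in coefficients composed with inversion. -/
theorem glRegular_comp_mem [Module.Finite k V] (hinv : ∀ f ∈ R, (fun x : G => f x⁻¹) ∈ R)
    (Φ : G →* ((K ⊗[k] V) ≃ₗ[K] (K ⊗[k] V)))
    (hcoeff : ∀ (v : V) (l : Module.Dual k V), matrixCoeff K v l ∘ Φ ∈ R)
    (F : ((K ⊗[k] V) ≃ₗ[K] (K ⊗[k] V)) → K) (hF : F ∈ glRegular k K V) : F ∘ Φ ∈ R := by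
  let P : (((K ⊗[k] V) ≃ₗ[K] (K ⊗[k] V)) → K) →ₐ[k] (G → K) :=
    AlgHom.pi (fun x => Pi.evalAlgHom k (fun _ => K) (Φ x))
  suffices h : glRegular k K V ≤ R.comap P from h hF
  refine Algebra.adjoin_le ?_
  rintro F (hF | rfl)
  · have : matrixCoeffs k K V ≤ R.toSubmodule.comap P.toLinearMap := by
      refine Submodule.span_le.2 ?_
      rintro F (rfl | ⟨v, l, rfl⟩)
      · exact one_mem R
      · exact hcoeff v l
    exact this hF
  · let B := Module.finBasis k V
    have h1 : P (fun g => (((LinearEquiv.det g)⁻¹ : Kˣ) : K)) =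
        fun x : G => (Matrix.of fun i j => (matrixCoeff K (B j) (B.coord i) ∘ Φ) x⁻¹).det := by
      funext x
      change (((LinearEquiv.det (Φ x))⁻¹ : Kˣ) : K) = _
      rw [← map_inv, ← map_inv, LinearEquiv.coe_det, ← LinearMap.det_toMatrix (B.baseChange K)]
      congr 1
      ext i j
      rw [LinearMap.toMatrix_apply, baseChange_repr_eq, Module.Basis.baseChange_apply]
      rfl
    change P _ ∈ R
    rw [h1]
    exact det_mem_of_entries_mem
      (f := fun i j x => (matrixCoeff K (B j) (B.coord i) ∘ Φ) x⁻¹) fun i j => hinv _ (hcoeff _ _)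

theorem exists_glRegular_comp_eq (Φ : G →* ((K ⊗[k] V) ≃ₗ[K] (K ⊗[k] V)))
    (hgen : R ≤ Algebra.adjoin k {f | ∃ (v : V) (l : Module.Dual k V), f = matrixCoeff K v l ∘ Φ})
    (f : G → K) (hf : f ∈ R) : ∃ F ∈ glRegular k K V, F ∘ Φ = f := by
  let P : (((K ⊗[k] V) ≃ₗ[K] (K ⊗[k] V)) → K) →ₐ[k] (G → K) :=
    AlgHom.pi (fun x => Pi.evalAlgHom k (fun _ => K) (Φ x))
  have h : R ≤ (glRegular k K V).map P := by
    refine hgen.trans (Algebra.adjoin_le ?_)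
    rintro _ ⟨v, l, rfl⟩
    exact ⟨_, matrixCoeff_mem_glRegular v l, rfl⟩
  exact h hf

/-- The transport of a representation along a linear equivalence. -/
def transportRep {G W W' : Type*} [Group G] [AddCommGroup W] [Module K W] [AddCommGroup W']
    [Module K W'] (e : W ≃ₗ[K] W') (f : G →* Module.End K W') : G →* (W ≃ₗ[K] W) where
  toFun x := LinearEquiv.ofLinearMap
    (e.symm.toLinearMap ∘ₗ f x ∘ₗ e.toLinearMap) (e.symm.toLinearMap ∘ₗ f x⁻¹ ∘ₗ e.toLinearMap)
    (by
      refine LinearMap.ext fun z => ?_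
      have h : f x * f x⁻¹ = 1 := by rw [← map_mul, mul_inv_cancel, map_one]
      have := LinearMap.congr_fun h (e z)
      simp_all)
    (by
      refine LinearMap.ext fun z => ?_
      have h : f x⁻¹ * f x = 1 := by rw [← map_mul, inv_mul_cancel, map_one]
      have := LinearMap.congr_fun h (e z)
      simp_all)
  map_one' := by
    refine LinearEquiv.ext fun z => ?_
    simp
  map_mul' x y := by
    refine LinearEquiv.ext fun z => ?_
    simp [LinearEquiv.mul_apply]

/-- A representation of `G` on `V_K` given in coordinates with respect to a `k`-basis of `V`. -/
noncomputable def coordinateRep {J : Type*} [Fintype J] (B : Module.Basis J k V)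
    (f : G →* Module.End K (J → K)) : G →* ((K ⊗[k] V) ≃ₗ[K] (K ⊗[k] V)) :=
  transportRep (B.baseChange K).equivFun f

theorem equivFun_coordinateRep {J : Type*} [Fintype J] (B : Module.Basis J k V)
    (f : G →* Module.End K (J → K)) (x : G) (z : K ⊗[k] V) :
    (B.baseChange K).equivFun (coordinateRep B f x z) = f x ((B.baseChange K).equivFun z) :=
  LinearEquiv.apply_symm_apply _ _

theorem equivFun_one_tmul {J : Type*} [Fintype J] (B : Module.Basis J k V) (v : V) :
    (B.baseChange K).equivFun (1 ⊗ₜ[k] v) = fun j => algebraMap k K (B.repr v j) := by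
  funext j
  simp [Algebra.smul_def]

theorem dual_baseChange_eq_sum {J : Type*} [Fintype J] (B : Module.Basis J k V)
    (l : Module.Dual k V) (z : K ⊗[k] V) : Module.Dual.baseChange K l z =
      ∑ i, algebraMap k K (l (B i)) * (B.baseChange K).equivFun z i := by
  conv_lhs => rw [← (B.baseChange K).sum_equivFun z]
  rw [map_sum]
  refine Finset.sum_congr rfl fun i _ => ?_
  rw [map_smul, Module.Basis.baseChange_apply]
  simp [Module.Dual.baseChange, Algebra.smul_def, mul_comm]

theorem matrixCoeff_coordinateRep {J : Type*} [Fintype J] [DecidableEq J] (B : Module.Basis J k V)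
    (f : G →* Module.End K (J → K)) (v : V) (l : Module.Dual k V) :
    matrixCoeff K v l ∘ coordinateRep B f =
      ∑ i, ∑ j, (l (B i) * B.repr v j) • fun x => f x (Pi.single j 1) i := by
  funext x
  have h2 : (fun j => algebraMap k K (B.repr v j)) =
      ∑ j, algebraMap k K (B.repr v j) • (Pi.single j 1 : J → K) := by
    funext j
    simp [Finset.sum_apply, Pi.single_apply, Algebra.algebraMap_eq_smul_one]
  simp only [Function.comp_apply, matrixCoeff, dual_baseChange_eq_sum B, equivFun_coordinateRep,
    equivFun_one_tmul, Finset.sum_apply, Pi.smul_apply]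
  refine Finset.sum_congr rfl fun i _ => ?_
  rw [h2, map_sum, Finset.sum_apply, Finset.mul_sum]
  refine Finset.sum_congr rfl fun j _ => ?_
  rw [map_smul, Pi.smul_apply, smul_eq_mul, Algebra.smul_def, map_mul, mul_assoc]

theorem coordinateRep_comp_mem {J : Type*} [Fintype J] [DecidableEq J] [Module.Finite k V]
    (hinv : ∀ f ∈ R, (fun x : G => f x⁻¹) ∈ R)
    (B : Module.Basis J k V) (f : G →* Module.End K (J → K))
    (hf : ∀ i j, (fun x => f x (Pi.single j 1) i) ∈ R)
    (F : ((K ⊗[k] V) ≃ₗ[K] (K ⊗[k] V)) → K) (hF : F ∈ glRegular k K V) :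
    F ∘ coordinateRep B f ∈ R := by
  refine glRegular_comp_mem hinv _ (fun v l => ?_) F hF
  rw [matrixCoeff_coordinateRep]
  exact sum_mem fun i _ => sum_mem fun j _ => Subalgebra.smul_mem _ (hf i j) _

theorem exists_coordinateRep_comp_eq {J : Type*} [Fintype J] [DecidableEq J]
    (B : Module.Basis J k V) (f : G →* Module.End K (J → K))
    (hgen : R ≤ Algebra.adjoin k {a | ∃ i j, a = fun x => f x (Pi.single j 1) i})
    (a : G → K) (ha : a ∈ R) : ∃ F ∈ glRegular k K V, F ∘ coordinateRep B f = a := by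
  refine exists_glRegular_comp_eq _ (hgen.trans (Algebra.adjoin_mono ?_)) a ha
  rintro _ ⟨i, j, rfl⟩
  refine ⟨B j, B.coord i, ?_⟩
  rw [matrixCoeff_coordinateRep]
  funext x
  simp [Finsupp.single_apply, ite_apply]

end GLCoefficients

/-! ### Comultiplication and finite-dimensional spaces of translates. -/

section Comultiplication

variable {k : Type*} [Field k] {K : Type*} [Field K] [Algebra k K] {X Y : Type*}

/-- Composition with `φ` as a homomorphism of algebras of functions. -/
def pullback (k K : Type*) [Field k] [Field K] [Algebra k K] {X Y : Type*} (φ : X → Y) :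
    (Y → K) →ₐ[k] (X → K) :=
  AlgHom.pi (fun x => Pi.evalAlgHom k (fun _ => K) (φ x))

@[simp]
theorem pullback_apply (φ : X → Y) (f : Y → K) (x : X) : pullback k K φ f x = f (φ x) := rfl

/-- The span of the functions `(x, y) ↦ a x * b y` with `a ∈ M` and `b ∈ N`. -/
def boxProd (M : Submodule k (X → K)) (N : Submodule k (Y → K)) : Submodule k (X × Y → K) :=
  M.map (pullback k K Prod.fst).toLinearMap * N.map (pullback k K Prod.snd).toLinearMap

theorem boxProd_mono {M M' : Submodule k (X → K)} {N N' : Submodule k (Y → K)} (h : M ≤ M')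
    (h' : N ≤ N') : boxProd M N ≤ boxProd M' N' :=
  mul_le_mul' (Submodule.map_mono h) (Submodule.map_mono h')

theorem boxProd_pow (M : Submodule k (X → K)) (N : Submodule k (Y → K)) (n : ℕ) :
    boxProd M N ^ n = boxProd (M ^ n) (N ^ n) := by
  rw [boxProd, mul_pow, ← Submodule.map_pow, ← Submodule.map_pow, boxProd]

theorem mul_mem_boxProd {M : Submodule k (X → K)} {N : Submodule k (Y → K)} {a : X → K}
    {b : Y → K} (ha : a ∈ M) (hb : b ∈ N) : (fun p => a p.1 * b p.2) ∈ boxProd M N :=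
  Submodule.mul_mem_mul (Submodule.mem_map_of_mem ha) (Submodule.mem_map_of_mem hb)

theorem boxProd_induction {M : Submodule k (X → K)} {N : Submodule k (Y → K)}
    {C : (X × Y → K) → Prop} {F : X × Y → K} (hF : F ∈ boxProd M N)
    (hmul : ∀ a ∈ M, ∀ b ∈ N, C (fun p => a p.1 * b p.2))
    (hadd : ∀ F F', C F → C F' → C (F + F')) : C F := by
  refine Submodule.mul_induction_on hF ?_ hadd
  rintro _ ⟨a, ha, rfl⟩ _ ⟨b, hb, rfl⟩
  exact hmul a ha b hb

theorem boxProd_span_right {ι : Type*} (M : Submodule k (X → K)) (b : ι → Y → K)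
    {F : X × Y → K} (hF : F ∈ boxProd M (Submodule.span k (Set.range b))) :
    ∃ c : ι →₀ M, ∀ x y, F (x, y) = c.sum fun i a => (a : X → K) x * b i y := by
  classical
  refine boxProd_induction (C := fun F => ∃ c : ι →₀ M, ∀ x y, F (x, y) =
    c.sum fun i a => (a : X → K) x * b i y) hF ?_ ?_
  · intro a ha f hf
    obtain ⟨l, rfl⟩ := (Finsupp.mem_span_range_iff_exists_finsupp).1 hf
    refine ⟨l.mapRange (fun t => t • (⟨a, ha⟩ : M)) (by simp), fun x y => ?_⟩
    rw [Finsupp.sum_mapRange_index (by simp)]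
    simp [Finsupp.sum, Finset.sum_apply, Finset.mul_sum]
  · rintro F F' ⟨c, hc⟩ ⟨c', hc'⟩
    refine ⟨c + c', fun x y => ?_⟩
    rw [Pi.add_apply, hc, hc', Finsupp.sum_add_index' (by simp) (by simp [add_mul])]

theorem boxProd_span_left {ι : Type*} [Fintype ι] (N : Submodule k (Y → K)) (b : ι → X → K)
    {F : X × Y → K} (hF : F ∈ boxProd (Submodule.span k (Set.range b)) N) :
    ∃ c : ι → Y → K, (∀ i, c i ∈ N) ∧ ∀ x y, F (x, y) = ∑ i, b i x * c i y := by
  have h : (fun p : Y × X => F (p.2, p.1)) ∈ boxProd N (Submodule.span k (Set.range b)) := by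
    refine boxProd_induction (C := fun F => (fun p : Y × X => F (p.2, p.1)) ∈ _) hF ?_ ?_
    · intro a ha f hf
      simpa only [mul_comm] using mul_mem_boxProd hf ha
    · exact fun F F' h h' => add_mem h h'
  obtain ⟨c, hc⟩ := boxProd_span_right N b h
  refine ⟨fun i => c i, fun i => (c i).2, fun x y => ?_⟩
  rw [hc y x, Finsupp.sum_fintype _ _ (by simp)]
  exact Finset.sum_congr rfl fun i _ => mul_comm _ _

variable {G : Type*} [Group G]

/-- The comultiplication `f ↦ ((x, y) ↦ f (x y))`. -/
def comul (k K G : Type*) [Field k] [Field K] [Algebra k K] [Group G] :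
    (G → K) →ₐ[k] (G × G → K) :=
  pullback k K fun p => p.1 * p.2

@[simp]
theorem comul_apply (f : G → K) (p : G × G) : comul k K G f p = f (p.1 * p.2) := rfl

theorem IsLinearAlgebraicGroup.comul_mem {R : Subalgebra k (G → K)}
    (hR : IsLinearAlgebraicGroup k R) {f : G → K} (hf : f ∈ R) :
    comul k K G f ∈ boxProd R.toSubmodule R.toSubmodule := by
  refine Submodule.span_le.2 ?_ (hR.mul_regular f hf)
  rintro _ ⟨a, ha, b, hb, rfl⟩
  exact mul_mem_boxProd (M := R.toSubmodule) (N := R.toSubmodule) ha hb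

/-- The space of translates of a regular function is finite-dimensional. -/
theorem IsLinearAlgebraicGroup.exists_translation_invariant {R : Subalgebra k (G → K)}
    (hR : IsLinearAlgebraicGroup k R) {f : G → K} (hf : f ∈ R) :
    ∃ M : Submodule k (G → K), M.FG ∧ f ∈ M ∧ M ≤ R.toSubmodule ∧
      M.map (comul k K G).toLinearMap ≤ boxProd M R.toSubmodule := by
  let B := Module.Basis.ofVectorSpace k R.toSubmodule
  have hB : Submodule.span k (Set.range fun i => (B i : G → K)) = R.toSubmodule := by
    have : (Set.range fun i => (B i : G → K)) = R.toSubmodule.subtype '' Set.range B := by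
      rw [← Set.range_comp]; rfl
    rw [this, ← Submodule.map_span, B.span_eq, Submodule.map_top, Submodule.range_subtype]
  have hexp : ∀ a ∈ R, ∃ c : _ →₀ R.toSubmodule, ∀ x y, a (x * y) =
      c.sum fun i b => (b : G → K) x * (B i : G → K) y := by
    intro a ha
    have h1 : comul k K G a ∈ boxProd R.toSubmodule
        (Submodule.span k (Set.range fun i => (B i : G → K))) := by
      rw [hB]; exact hR.comul_mem ha
    obtain ⟨c, hc⟩ := boxProd_span_right _ _ h1
    exact ⟨c, hc⟩
  -- The coordinate functionals must be `K`-linear: for fixed `x`, the function `y ↦ a (x * y)` is a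
  -- combination of the `B i` with coefficients in `K` only.
  have hcoord : ∀ i, ∃ s : (G → K) →ₗ[K] K, ∀ r : R.toSubmodule,
      s r = algebraMap k K (B.repr r i) := fun i =>
    exists_linear_extension (R := R.toSubmodule) hR.linearIndep
      ((Algebra.linearMap k K) ∘ₗ B.coord i)
  choose s hs using hcoord
  classical
  have hsB : ∀ i j, s i (B j) = if j = i then 1 else 0 := by
    intro i j
    rw [hs, B.repr_self, Finsupp.single_apply]
    split <;> simp
  have hcoef : ∀ (a : G → K) (c : _ →₀ R.toSubmodule), (∀ x y, a (x * y) =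
      c.sum fun i b => (b : G → K) x * (B i : G → K) y) →
      ∀ i x, s i (fun y => a (x * y)) = (c i : G → K) x := by
    intro a c hc i x
    have : (fun y => a (x * y)) = c.sum fun j b => (b : G → K) x • (B j : G → K) := by
      funext y
      rw [hc x y]
      simp [Finsupp.sum, Finset.sum_apply]
    rw [this, Finsupp.sum, map_sum]
    simp only [map_smul, hsB, smul_eq_mul, mul_ite, mul_one, mul_zero]
    rw [Finset.sum_ite_eq' c.support i]
    split_ifs with h
    · rfl
    · rw [Finsupp.notMem_support_iff.1 h]; rfl
  obtain ⟨c, hc⟩ := hexp f hf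
  refine ⟨Submodule.span k (Set.range fun i : c.support => (c i : G → K)),
    Submodule.fg_span (Set.finite_range _), ?_, ?_, ?_⟩
  -- The expansion at `y = 1`; rationality of the identity puts the coefficients in `k`.
  · have : f = c.sum fun i b => (B i : G → K) 1 • (b : G → K) := by
      funext x
      have h1 := hc x 1
      rw [mul_one] at h1
      rw [h1]
      simp [Finsupp.sum, Finset.sum_apply, mul_comm]
    rw [this]
    refine sum_mem fun i hi => ?_
    obtain ⟨t, ht⟩ := hR.one_rational _ (B i).2
    change (B i : G → K) 1 • (c i : G → K) ∈ _
    rw [ht, algebraMap_smul]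
    exact Submodule.smul_mem _ _ (Submodule.subset_span ⟨⟨i, hi⟩, rfl⟩)
  · rw [Submodule.span_le]
    rintro _ ⟨i, rfl⟩
    exact (c i).2
  · rw [Submodule.map_span, Submodule.span_le]
    rintro _ ⟨_, ⟨i, rfl⟩, rfl⟩
    choose C hC using fun j => hexp _ (B j).2
    have : (comul k K G).toLinearMap (c i) =
        c.sum fun j b => fun p => (b : G → K) p.1 * (C j i : G → K) p.2 := by
      funext p
      have h1 : (fun w => f (p.1 * p.2 * w)) =
          c.sum fun j b => (b : G → K) p.1 • fun w => (B j : G → K) (p.2 * w) := by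
        funext w
        rw [mul_assoc, hc]
        simp [Finsupp.sum, Finset.sum_apply]
      -- Coassociativity: `f (x y w)` is expanded once with `x y` as left factor and once with `x`
      -- alone.
      calc (c i : G → K) (p.1 * p.2) = s i (fun w => f (p.1 * p.2 * w)) := (hcoef f c hc i _).symm
        _ = c.sum fun j b => (b : G → K) p.1 * (C j i : G → K) p.2 := by
          rw [h1, Finsupp.sum, map_sum]
          refine Finset.sum_congr rfl fun j _ => ?_
          rw [map_smul, hcoef _ _ (hC j), smul_eq_mul]
        _ = _ := by simp [Finsupp.sum, Finset.sum_apply]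
    rw [this]
    refine sum_mem fun j hj => ?_
    exact mul_mem_boxProd (Submodule.subset_span ⟨⟨j, hj⟩, rfl⟩) (C j i).2

/-- The matrices of right translation in a linearly independent family of functions. -/
theorem exists_translationMatrix {ι : Type*} [Fintype ι] [DecidableEq ι] {b : ι → G → K}
    (hb : LinearIndependent K b) {c : ι → ι → G → K}
    (hc : ∀ i x y, b i (x * y) = ∑ j, b j x * c j i y) :
    ∃ ρ : G →* Matrix ι ι K, ∀ x j i, ρ x j i = c j i x := by
  -- Coefficients with respect to `b` are unique, so comparing expansions of `b i (x * 1)` and of `b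
  -- i (x * y * z)` yields both homomorphism laws.
  have hinj : ∀ v v' : ι → K, (∀ x, ∑ j, b j x * v j = ∑ j, b j x * v' j) → v = v' := by
    intro v v' h
    funext j
    refine sub_eq_zero.1 (Fintype.linearIndependent_iff.1 hb (fun j => v j - v' j) ?_ j)
    funext x
    have := h x
    simp only [Finset.sum_apply, Pi.smul_apply, smul_eq_mul, sub_mul, Finset.sum_sub_distrib,
      Pi.zero_apply]
    rw [sub_eq_zero]
    simpa only [mul_comm] using this
  refine ⟨⟨⟨fun x => Matrix.of fun j i => c j i x, ?_⟩, ?_⟩, fun _ _ _ => rfl⟩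
  · ext j i
    refine congrFun (hinj (fun j => c j i 1) (fun j => (1 : Matrix ι ι K) j i) fun x => ?_) j
    rw [← hc, mul_one]
    simp [Matrix.one_apply]
  · intro y z
    ext j i
    refine congrFun (hinj (fun j => c j i (y * z)) (fun j => ∑ l, c j l y * c l i z) fun x => ?_) j
    rw [← hc, ← mul_assoc, hc]
    simp only [hc, Finset.sum_mul, Finset.mul_sum]
    rw [Finset.sum_comm]
    exact Finset.sum_congr rfl fun _ _ => Finset.sum_congr rfl fun _ _ => mul_assoc _ _ _

end Comultiplication

/-! ### Degrees of defining equations in `GL(V_K)`. -/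

section Degree

variable {k : Type*} [Field k] {K : Type*} [Field K] [Algebra k K]
  {V : Type*} [AddCommGroup V] [Module k V]

theorem matrixCoeff_eq_sum {ι : Type*} [Fintype ι] (B : Module.Basis ι k V) (v : V)
    (l : Module.Dual k V) : matrixCoeff K v l =
      ∑ i, ∑ j, (l (B i) * B.repr v j) • matrixCoeff K (B j) (B.coord i) := by
  funext g
  have hv : (1 : K) ⊗ₜ[k] v = ∑ j, algebraMap k K (B.repr v j) • ((1 : K) ⊗ₜ[k] B j) := by
    conv_lhs => rw [← B.sum_repr v]
    simp only [TensorProduct.tmul_sum, TensorProduct.tmul_smul, algebraMap_smul]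
  simp only [matrixCoeff, Finset.sum_apply, Pi.smul_apply]
  rw [dual_baseChange_eq_sum B]
  refine Finset.sum_congr rfl fun i _ => ?_
  rw [Module.Basis.equivFun_apply, baseChange_repr_eq, hv, map_sum, map_sum, Finset.mul_sum]
  refine Finset.sum_congr rfl fun j _ => ?_
  rw [map_smul, map_smul, smul_eq_mul, Algebra.smul_def, map_mul, mul_assoc]

theorem matrixCoeffs_eq_span {ι : Type*} [Fintype ι] (B : Module.Basis ι k V) :
    matrixCoeffs k K V = Submodule.span k
      (insert 1 (Set.range fun p : ι × ι => matrixCoeff K (B p.2) (B.coord p.1))) := by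
  apply le_antisymm
  · refine Submodule.span_le.2 ?_
    rintro F (rfl | ⟨v, l, rfl⟩)
    · exact Submodule.subset_span (Or.inl rfl)
    · change matrixCoeff K v l ∈ _
      rw [matrixCoeff_eq_sum B]
      exact sum_mem fun i _ => sum_mem fun j _ => Submodule.smul_mem _ _
        (Submodule.subset_span (Or.inr ⟨(i, j), rfl⟩))
  · refine Submodule.span_le.2 ?_
    rintro F (rfl | ⟨p, rfl⟩)
    · exact Submodule.subset_span (Or.inl rfl)
    · exact matrixCoeff_mem_matrixCoeffs _ _

theorem one_mem_matrixCoeffs : 1 ≤ matrixCoeffs k K V :=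
  Submodule.one_le.2 (Submodule.subset_span (Or.inl rfl))

theorem mem_pow_of_le {X : Type*} {M : Submodule k (X → K)} (hM : 1 ≤ M)
    {m n : ℕ} (h : m ≤ n) {a : X → K} (ha : a ∈ M ^ m) : a ∈ M ^ n :=
  (pow_le_pow_right' hM h : M ^ m ≤ M ^ n) ha

theorem exists_mem_pow_of_mem_adjoin {X : Type*} {M : Submodule k (X → K)}
    (hM : 1 ≤ M) {a : X → K} (ha : a ∈ Algebra.adjoin k (M : Set (X → K))) : ∃ h : ℕ, a ∈ M ^ h := by
  induction ha using Algebra.adjoin_induction with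
  | mem a ha => exact ⟨1, by simpa using ha⟩
  | algebraMap c => exact ⟨0, by rw [pow_zero]; exact Submodule.algebraMap_mem c⟩
  | add a b _ _ ha hb =>
    obtain ⟨m, hm⟩ := ha
    obtain ⟨n, hn⟩ := hb
    exact ⟨m + n, add_mem (mem_pow_of_le hM (Nat.le_add_right m n) hm)
      (mem_pow_of_le hM (Nat.le_add_left n m) hn)⟩
  | mul a b _ _ ha hb =>
    obtain ⟨m, hm⟩ := ha
    obtain ⟨n, hn⟩ := hb
    exact ⟨m + n, by rw [pow_add]; exact Submodule.mul_mem_mul hm hn⟩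

theorem IsDefinedInDegree.mono {h h' : ℕ} (hh : h ≤ h')
    {H : Set ((K ⊗[k] V) ≃ₗ[K] (K ⊗[k] V))} (hH : IsDefinedInDegree k K V h H) :
    IsDefinedInDegree k K V h' H := by
  refine ⟨hH.1, le_antisymm ?_ (Ideal.span_le.2 fun f hf => hf.1)⟩
  conv_lhs => rw [hH.2]
  exact Ideal.span_mono fun f hf => ⟨hf.1, mem_pow_of_le one_mem_matrixCoeffs hh hf.2⟩

theorem isNoetherianRing_regularFunctions_glRegular [Module.Finite k V] :
    IsNoetherianRing (regularFunctions (glRegular k K V)) := by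
  let B := Module.finBasis k V
  let T : Set (((K ⊗[k] V) ≃ₗ[K] (K ⊗[k] V)) → K) :=
    insert 1 (Set.range fun p : Fin (Module.finrank k V) × Fin (Module.finrank k V) =>
      matrixCoeff K (B p.2) (B.coord p.1)) ∪ {fun g => (((LinearEquiv.det g)⁻¹ : Kˣ) : K)}
  have hT : T.Finite := ((Set.finite_range _).insert _).union (Set.finite_singleton _)
  have h0 : glRegular k K V = Algebra.adjoin k T := by
    rw [glRegular, matrixCoeffs_eq_span B, Algebra.adjoin_union, Algebra.adjoin_span,
      ← Algebra.adjoin_union]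
  have h : regularFunctions (glRegular k K V) = Algebra.adjoin K T := by
    rw [regularFunctions, h0, Algebra.adjoin_adjoin_of_tower]
  rw [h]
  have : Algebra.FiniteType K (Algebra.adjoin K T) :=
    (Subalgebra.fg_iff_finiteType _).1 (Subalgebra.fg_def.2 ⟨T, hT, rfl⟩)
  have := Algebra.FiniteType.isNoetherianRing K (Algebra.adjoin K T)
  exact this

theorem det_mem_adjoin_matrixCoeffs [Module.Finite k V] :
    (fun g : (K ⊗[k] V) ≃ₗ[K] (K ⊗[k] V) => ((LinearEquiv.det g : Kˣ) : K)) ∈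
      Algebra.adjoin k (matrixCoeffs k K V : Set (((K ⊗[k] V) ≃ₗ[K] (K ⊗[k] V)) → K)) := by
  let B := Module.finBasis k V
  have h1 : (fun g : (K ⊗[k] V) ≃ₗ[K] (K ⊗[k] V) => ((LinearEquiv.det g : Kˣ) : K)) =
      fun g => (Matrix.of fun i j => matrixCoeff K (B j) (B.coord i) g).det := by
    funext g
    rw [LinearEquiv.coe_det, ← LinearMap.det_toMatrix (B.baseChange K)]
    congr 1
    ext i j
    rw [LinearMap.toMatrix_apply, baseChange_repr_eq, Module.Basis.baseChange_apply]
    rfl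
  rw [h1]
  exact det_mem_of_entries_mem (f := fun i j => matrixCoeff K (B j) (B.coord i))
    fun i j => Algebra.subset_adjoin (matrixCoeff_mem_matrixCoeffs _ _)

/-- A power of the determinant turns each generator over `k` into a polynomial, and it can be
divided out again since the determinant is a unit. The ideals generated by the equations of degree
at most `h` increase with `h` and stabilize because the coordinate ring is Noetherian. -/
theorem IsDefinedOver.exists_isDefinedInDegree [Module.Finite k V]
    {H : Set ((K ⊗[k] V) ≃ₗ[K] (K ⊗[k] V))} (hH : IsDefinedOver (glRegular k K V) H) :
    ∃ h, IsDefinedInDegree k K V h H := by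
  let D : ((K ⊗[k] V) ≃ₗ[K] (K ⊗[k] V)) → K := fun g => ((LinearEquiv.det g : Kˣ) : K)
  let D' : ((K ⊗[k] V) ≃ₗ[K] (K ⊗[k] V)) → K := fun g => (((LinearEquiv.det g)⁻¹ : Kˣ) : K)
  have hDD' : D * D' = 1 := by
    funext g
    exact Units.mul_inv _
  let Pol := Algebra.adjoin k (matrixCoeffs k K V : Set (((K ⊗[k] V) ≃ₗ[K] (K ⊗[k] V)) → K))
  have hD : D ∈ Pol := det_mem_adjoin_matrixCoeffs
  have hPol : Pol ≤ glRegular k K V := Algebra.adjoin_mono Set.subset_union_left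
  have hmul : ∀ F ∈ glRegular k K V, ∃ n : ℕ, F * D ^ n ∈ Pol := by
    intro F hF
    induction hF using Algebra.adjoin_induction with
    | mem F hF =>
      rcases hF with hF | rfl
      · exact ⟨0, by simpa using Algebra.subset_adjoin hF⟩
      · exact ⟨1, by
          rw [pow_one, mul_comm]
          change D * D' ∈ Pol
          rw [hDD']
          exact one_mem _⟩
    | algebraMap c => exact ⟨0, by simp⟩
    | add a b _ _ ha hb =>
      obtain ⟨m, hm⟩ := ha
      obtain ⟨n, hn⟩ := hb
      refine ⟨m + n, ?_⟩
      have : (a + b) * D ^ (m + n) = (a * D ^ m) * D ^ n + (b * D ^ n) * D ^ m := by ring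
      rw [this]
      exact add_mem (mul_mem hm (pow_mem hD n)) (mul_mem hn (pow_mem hD m))
    | mul a b _ _ ha hb =>
      obtain ⟨m, hm⟩ := ha
      obtain ⟨n, hn⟩ := hb
      refine ⟨m + n, ?_⟩
      have : (a * b) * D ^ (m + n) = (a * D ^ m) * (b * D ^ n) := by ring
      rw [this]
      exact mul_mem hm hn
  let I := vanishingIdeal (glRegular k K V) H
  let J : ℕ →o Ideal (regularFunctions (glRegular k K V)) :=
    ⟨fun h => Ideal.span {f | f ∈ I ∧
        (f : ((K ⊗[k] V) ≃ₗ[K] (K ⊗[k] V)) → K) ∈ matrixCoeffs k K V ^ h},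
      fun h h' hh => Ideal.span_mono fun f hf =>
        ⟨hf.1, mem_pow_of_le one_mem_matrixCoeffs hh hf.2⟩⟩
  have hnoeth := isNoetherianRing_regularFunctions_glRegular (k := k) (K := K) (V := V)
  obtain ⟨n, hn⟩ := monotone_stabilizes_iff_noetherian.2 hnoeth J
  have hJ : ∀ h, J h ≤ J n := fun h => (le_total h n).elim (fun h1 => J.mono h1)
    fun h1 => (hn h h1).ge
  refine ⟨n, hH.1, le_antisymm ?_ (Ideal.span_le.2 fun f hf => hf.1)⟩
  conv_lhs => rw [hH.2]
  refine Ideal.span_le.2 ?_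
  rintro f ⟨hfI, hf⟩
  obtain ⟨a, ha⟩ := hmul _ hf
  obtain ⟨h, hh⟩ := exists_mem_pow_of_mem_adjoin one_mem_matrixCoeffs ha
  let d : regularFunctions (glRegular k K V) := ⟨D, Algebra.subset_adjoin (hPol hD)⟩
  let d' : regularFunctions (glRegular k K V) :=
    ⟨D', Algebra.subset_adjoin (Algebra.subset_adjoin (Or.inr rfl))⟩
  have hdd' : d * d' = 1 := Subtype.ext hDD'
  have h1 : f * d ^ a ∈ J h := Ideal.subset_span ⟨I.mul_mem_right _ hfI, hh⟩
  have h2 := Ideal.mul_mem_right (d' ^ a) _ (hJ h h1)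
  rwa [mul_assoc, ← mul_pow, hdd', one_pow, mul_one] at h2

end Degree

/-! ### Every linear algebraic `k`-group is a closed subgroup of some `GL_m`. -/

section LinearRealization

variable {k : Type*} [Field k] {K : Type*} [Field K] [Algebra k K] {G : Type*} [Group G]
  {R : Subalgebra k (G → K)}

theorem IsLinearAlgebraicGroup.exists_generating_comodule (hR : IsLinearAlgebraicGroup k R) :
    ∃ M : Submodule k (G → K), M.FG ∧ M ≤ R.toSubmodule ∧
      M.map (comul k K G).toLinearMap ≤ boxProd M R.toSubmodule ∧
      R ≤ Algebra.adjoin k (M : Set (G → K)) := by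
  obtain ⟨s, hs⟩ := hR.fg
  have hsR : ∀ f ∈ s, f ∈ R := fun f hf => by rw [← hs]; exact Algebra.subset_adjoin hf
  choose M h1 h2 h3 h4 using fun f : s => hR.exists_translation_invariant (hsR f f.2)
  refine ⟨⨆ f, M f, Submodule.fg_iSup _ h1, iSup_le h3, ?_, ?_⟩
  · rw [Submodule.map_iSup]
    exact iSup_le fun f => (h4 f).trans (boxProd_mono (le_iSup M f) le_rfl)
  · rw [← hs]
    exact Algebra.adjoin_mono fun f hf => le_iSup M ⟨f, hf⟩ (h2 ⟨f, hf⟩)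

/-- A basis of a finite-dimensional space of functions, as a family of functions. -/
theorem exists_basis_family {X : Type*} {M : Submodule k (X → K)} (hM : M.FG) :
    ∃ b : Fin (Module.finrank k M) → X → K, LinearIndependent k b ∧
      Submodule.span k (Set.range b) = M := by
  have : Module.Finite k M := Module.Finite.iff_fg.2 hM
  let B := Module.finBasis k M
  refine ⟨fun i => B i, B.linearIndependent.map' M.subtype (Submodule.ker_subtype M), ?_⟩
  have : (Set.range fun i => (B i : X → K)) = M.subtype '' Set.range B := by
    rw [← Set.range_comp]; rfl
  rw [this, ← Submodule.map_span, B.span_eq, Submodule.map_top, Submodule.range_subtype]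

/-- `G` acts by right translations on a finite-dimensional space generating `k[G]`. The matrix
entries `c i j` generate too, because `b i = ∑ j, b j 1 • c i j` with `b j 1` in `k`. -/
theorem IsLinearAlgebraicGroup.exists_hasLinearRealization (hR : IsLinearAlgebraicGroup k R) :
    ∃ m h : ℕ, HasLinearRealization k R m h := by
  obtain ⟨M, hfg, hMR, hM, hgen⟩ := hR.exists_generating_comodule
  obtain ⟨b, hb, hbM⟩ := exists_basis_family hfg
  rw [← hbM] at hgen
  have hbmem : ∀ i, b i ∈ M := fun i => hbM.le (Submodule.subset_span ⟨i, rfl⟩)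
  have hbK : LinearIndependent K b :=
    linearIndependent_of_mem hR.linearIndep (fun i => hMR (hbmem i)) hb
  have hex : ∀ i, ∃ c : _ → G → K, (∀ j, c j ∈ R.toSubmodule) ∧
      ∀ x y, comul k K G (b i) (x, y) = ∑ j, b j x * c j y := by
    intro i
    refine boxProd_span_left R.toSubmodule b ?_
    rw [hbM]
    exact hM (Submodule.mem_map_of_mem (hbmem i))
  choose c hcR hc using hex
  obtain ⟨ρ, hρ⟩ := exists_translationMatrix hbK (c := fun j i => c i j) hc
  let f : G →* Module.End K (Fin (Module.finrank k M) → K) :=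
    (Matrix.toLinAlgEquiv' : Matrix _ _ K ≃ₐ[K] _).toAlgHom.toMonoidHom.comp ρ
  have hf : ∀ i j, (fun x => f x (Pi.single j 1) i) = c j i := by
    intro i j
    funext x
    rw [← hρ x i j]
    simp [f]
  let B := Pi.basisFun k (Fin (Module.finrank k M))
  have h1 := coordinateRep_comp_mem hR.inv_regular B f (fun i j => by rw [hf]; exact hcR j i)
  have h2 : R ≤ Algebra.adjoin k {a | ∃ i j, a = fun x => f x (Pi.single j 1) i} := by
    refine hgen.trans (Algebra.adjoin_le ?_)
    refine (Submodule.span_le (p := Subalgebra.toSubmodule (Algebra.adjoin k _))).2 ?_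
    rintro _ ⟨i, rfl⟩
    have h3 : b i = ∑ j, b j 1 • c i j := by
      funext x
      have := hc i 1 x
      rw [comul_apply, one_mul] at this
      rw [this]
      simp [Finset.sum_apply]
    rw [h3]
    refine sum_mem fun j _ => ?_
    obtain ⟨t, ht⟩ := hR.one_rational _ (hMR (hbmem j))
    rw [ht, algebraMap_smul]
    exact Submodule.smul_mem _ _ (Algebra.subset_adjoin ⟨j, i, (hf j i).symm⟩)
  have h3 := exists_coordinateRep_comp_eq B f h2
  obtain ⟨h, hh⟩ := (isDefinedOver_range hR.toIsAffineVariety glRegular_separates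
    (coordinateRep B f) h1 h3).exists_isDefinedInDegree
  exact ⟨_, h, (coordinateRep B f).range, by rwa [MonoidHom.coe_range],
    isKIsomorphic_range hR.toIsAffineVariety _ h1 h3 _ rfl⟩

end LinearRealization

/-! ### The structure algebra and its simplicity. -/

section StructureAlgebra

/-- The index set of a basis of the structure algebra: the left identity, then bases of the
spaces `M`, `M*`, `N`, and finally `d` elements acting on `M`. -/
abbrev StructIndex (d r : ℕ) : Type := Unit ⊕ Fin d ⊕ Fin d ⊕ Fin r ⊕ Fin d

/-- The summand containing a basis element. -/
def StructIndex.sort {d r : ℕ} : StructIndex d r → Fin 4 ⊕ Fin d :=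
  Sum.elim (fun _ => Sum.inl 0) (Sum.elim (fun _ => Sum.inl 1) (Sum.elim (fun _ => Sum.inl 2)
    (Sum.elim (fun _ => Sum.inl 3) Sum.inr)))

/-- The data defining a structure algebra: the eigenvalues of the right multiplication by the
left identity, a bilinear map `M × N → M*`, operators on `M`, and a vector in `M`. -/
structure StructDatum (F : Type*) (d r : ℕ) where
  weight : Fin 4 ⊕ Fin d → F
  pair : Fin d → Fin d → Fin r → F
  op : Fin d → Fin d → Fin d → F
  vec : Fin d → F

/-- The change of scalars of a datum. -/
def StructDatum.map {F F' : Type*} {d r : ℕ} (φ : F → F') (D : StructDatum F d r) :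
    StructDatum F' d r :=
  ⟨fun i => φ (D.weight i), fun i j l => φ (D.pair i j l), fun c i l => φ (D.op c i l),
    fun i => φ (D.vec i)⟩

variable {F : Type*} [Field F] {d r : ℕ}

/-- The coordinate at the left identity. -/
def unitPart : (StructIndex d r → F) →ₗ[F] F := LinearMap.proj (Sum.inl ())

/-- The component in `M`. -/
def mainPart : (StructIndex d r → F) →ₗ[F] (Fin d → F) :=
  LinearMap.funLeft F F fun i => Sum.inr (Sum.inl i)

/-- The component in `M*`. -/
def dualPart : (StructIndex d r → F) →ₗ[F] (Fin d → F) :=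
  LinearMap.funLeft F F fun i => Sum.inr (Sum.inr (Sum.inl i))

/-- The component in `N`. -/
def formPart : (StructIndex d r → F) →ₗ[F] (Fin r → F) :=
  LinearMap.funLeft F F fun i => Sum.inr (Sum.inr (Sum.inr (Sum.inl i)))

/-- The component in the span of the elements acting on `M`. -/
def opPart : (StructIndex d r → F) →ₗ[F] (Fin d → F) :=
  LinearMap.funLeft F F fun i => Sum.inr (Sum.inr (Sum.inr (Sum.inr i)))

/-- The element with the given components. -/
def structMk (a : F) (m m' : Fin d → F) (n : Fin r → F) (c : Fin d → F) : StructIndex d r → F :=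
  Sum.elim (fun _ => a) (Sum.elim m (Sum.elim m' (Sum.elim n c)))

section Parts

variable (a : F) (m m' : Fin d → F) (n : Fin r → F) (c : Fin d → F)

@[simp] theorem unitPart_structMk : unitPart (structMk a m m' n c) = a := rfl
@[simp] theorem mainPart_structMk : mainPart (structMk a m m' n c) = m := rfl
@[simp] theorem dualPart_structMk : dualPart (structMk a m m' n c) = m' := rfl
@[simp] theorem formPart_structMk : formPart (structMk a m m' n c) = n := rfl
@[simp] theorem opPart_structMk : opPart (structMk a m m' n c) = c := rfl

end Parts

theorem structMk_parts (x : StructIndex d r → F) :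
    structMk (unitPart x) (mainPart x) (dualPart x) (formPart x) (opPart x) = x := by
  funext j
  rcases j with j | j | j | j | j <;> rfl

theorem struct_ext {x y : StructIndex d r → F} (h1 : unitPart x = unitPart y)
    (h2 : mainPart x = mainPart y) (h3 : dualPart x = dualPart y) (h4 : formPart x = formPart y)
    (h5 : opPart x = opPart y) : x = y := by
  rw [← structMk_parts x, ← structMk_parts y, h1, h2, h3, h4, h5]

theorem structMk_add (a b : F) (m₁ m₂ m₁' m₂' : Fin d → F) (n₁ n₂ : Fin r → F) (c₁ c₂ : Fin d → F) :
    structMk a m₁ m₁' n₁ c₁ + structMk b m₂ m₂' n₂ c₂ =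
      structMk (a + b) (m₁ + m₂) (m₁' + m₂') (n₁ + n₂) (c₁ + c₂) :=
  struct_ext rfl rfl rfl rfl rfl

theorem smul_structMk (t a : F) (m m' : Fin d → F) (n : Fin r → F) (c : Fin d → F) :
    t • structMk a m m' n c = structMk (t * a) (t • m) (t • m') (t • n) (t • c) :=
  struct_ext rfl rfl rfl rfl rfl

namespace StructDatum

variable (D : StructDatum F d r)

/-- The action of the operators on `M`. -/
def act : (Fin d → F) →ₗ[F] (Fin d → F) →ₗ[F] (Fin d → F) :=
  LinearMap.mk₂ F (fun m c l => ∑ i, ∑ j, m i * c j * D.op j i l)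
    (fun a b c => by funext l; simp [add_mul, Finset.sum_add_distrib])
    (fun t a c => by funext l; simp [Finset.mul_sum, mul_assoc])
    (fun a b c => by funext l; simp [mul_add, add_mul, Finset.sum_add_distrib])
    (fun t a c => by funext l; simp [Finset.mul_sum, mul_assoc, mul_left_comm])

/-- The bilinear map `M × N → M*`. -/
def form : (Fin d → F) →ₗ[F] (Fin r → F) →ₗ[F] (Fin d → F) :=
  LinearMap.mk₂ F (fun m n j => ∑ i, ∑ l, m i * n l * D.pair i j l)
    (fun a b c => by funext l; simp [add_mul, Finset.sum_add_distrib])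
    (fun t a c => by funext l; simp [Finset.mul_sum, mul_assoc])
    (fun a b c => by funext l; simp [mul_add, add_mul, Finset.sum_add_distrib])
    (fun t a c => by funext l; simp [Finset.mul_sum, mul_assoc, mul_left_comm])

theorem act_apply (m c : Fin d → F) (l : Fin d) :
    D.act m c l = ∑ i, ∑ j, m i * c j * D.op j i l := rfl

theorem form_apply (m : Fin d → F) (n : Fin r → F) (j : Fin d) :
    D.form m n j = ∑ i, ∑ l, m i * n l * D.pair i j l := rfl

/-- The multiplication of the structure algebra. -/
def mul : (StructIndex d r → F) →ₗ[F] (StructIndex d r → F) →ₗ[F] (StructIndex d r → F) :=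
  -- The unit part of the left factor acts by scalars, that of the right factor by the weights. The
  -- product `opPart x * opPart y` is coordinatewise, so the operators are orthogonal and `c_i² = e
  -- + vec + c_i`. No weight appears on the unit line, where the eigenvalue is 1.
  LinearMap.mk₂ F (fun x y => structMk
      (unitPart x * unitPart y + mainPart x ⬝ᵥ dualPart y + opPart x ⬝ᵥ opPart y)
      (unitPart x • mainPart y + (D.weight (Sum.inl 1) * unitPart y) • mainPart x +
        D.act (mainPart x) (opPart y) + (opPart x ⬝ᵥ opPart y) • D.vec)
      (unitPart x • dualPart y + (D.weight (Sum.inl 2) * unitPart y) • dualPart x +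
        D.form (mainPart x) (formPart y))
      (unitPart x • formPart y + (D.weight (Sum.inl 3) * unitPart y) • formPart x)
      (unitPart x • opPart y + unitPart y • ((fun i => D.weight (Sum.inr i)) * opPart x) +
        opPart x * opPart y))
    (fun a b c => by
      rw [structMk_add]
      simp only [map_add, LinearMap.add_apply, add_dotProduct, add_mul, add_smul, smul_add, mul_add]
      congr 1 <;> abel)
    (fun t a c => by
      rw [smul_structMk]
      simp only [map_smul, LinearMap.smul_apply, smul_dotProduct, smul_eq_mul, smul_add, mul_add,
        smul_smul, mul_smul_comm, mul_comm, mul_left_comm])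
    (fun a b c => by
      rw [structMk_add]
      simp only [map_add, dotProduct_add, add_smul, smul_add, mul_add]
      congr 1 <;> abel)
    (fun t a c => by
      rw [smul_structMk]
      simp only [map_smul, dotProduct_smul, smul_eq_mul, smul_add, mul_add,
        smul_smul, mul_smul_comm, mul_comm, mul_left_comm])

variable (x y : StructIndex d r → F)

theorem unitPart_mul : unitPart (D.mul x y) =
    unitPart x * unitPart y + mainPart x ⬝ᵥ dualPart y + opPart x ⬝ᵥ opPart y := rfl

theorem mainPart_mul : mainPart (D.mul x y) =
    unitPart x • mainPart y + (D.weight (Sum.inl 1) * unitPart y) • mainPart x +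
        D.act (mainPart x) (opPart y) + (opPart x ⬝ᵥ opPart y) • D.vec := rfl

theorem dualPart_mul : dualPart (D.mul x y) =
    unitPart x • dualPart y + (D.weight (Sum.inl 2) * unitPart y) • dualPart x +
        D.form (mainPart x) (formPart y) := rfl

theorem formPart_mul : formPart (D.mul x y) =
    unitPart x • formPart y + (D.weight (Sum.inl 3) * unitPart y) • formPart x := rfl

theorem opPart_mul : opPart (D.mul x y) =
    unitPart x • opPart y + unitPart y • ((fun i => D.weight (Sum.inr i)) * opPart x) +
        opPart x * opPart y := rfl

/-- The left identity of the structure algebra. -/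
def unit (F : Type*) [Field F] (d r : ℕ) : StructIndex d r → F := structMk 1 0 0 0 0

/-- The nondegeneracy conditions under which the structure algebra is simple. -/
structure Nondegenerate : Prop where
  weight_injective : Function.Injective D.weight
  weight_unit : D.weight (Sum.inl 0) = 1
  weight_ne_zero : ∀ i, D.weight i ≠ 0
  -- Injectivity of `N → Hom(M, M*)`, given by an explicit left inverse so that it passes to
  -- extension fields.
  form_separates : ∃ q : Fin r → Fin d → Fin d → F,
    ∀ l l', ∑ i, ∑ j, q l i j * D.pair i j l' = if l = l' then 1 else 0

theorem Nondegenerate.map {D : StructDatum F d r} (hD : D.Nondegenerate) {F' : Type*} [Field F']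
    (φ : F →+* F') : (D.map φ).Nondegenerate where
  weight_injective := φ.injective.comp hD.weight_injective
  weight_unit := by simp [StructDatum.map, hD.weight_unit]
  weight_ne_zero i := by simpa [StructDatum.map] using hD.weight_ne_zero i
  form_separates := by
    obtain ⟨q, hq⟩ := hD.form_separates
    refine ⟨fun l i j => φ (q l i j), fun l l' => ?_⟩
    have := congrArg φ (hq l l')
    simpa [StructDatum.map, apply_ite φ] using this

theorem map_mul_map {F' : Type*} [Field F'] (φ : F →+* F') :
    (D.map φ).mul (fun j => φ (x j)) (fun j => φ (y j)) = fun j => φ (D.mul x y j) := by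
  have h1 : ∀ z : StructIndex d r → F, unitPart (fun j => φ (z j)) = φ (unitPart z) := fun _ => rfl
  have h2 : ∀ z : StructIndex d r → F, mainPart (fun j => φ (z j)) = fun i => φ (mainPart z i) :=
    fun _ => rfl
  have h3 : ∀ z : StructIndex d r → F, dualPart (fun j => φ (z j)) = fun i => φ (dualPart z i) :=
    fun _ => rfl
  have h4 : ∀ z : StructIndex d r → F, formPart (fun j => φ (z j)) = fun i => φ (formPart z i) :=
    fun _ => rfl
  have h5 : ∀ z : StructIndex d r → F, opPart (fun j => φ (z j)) = fun i => φ (opPart z i) :=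
    fun _ => rfl
  refine struct_ext ?_ ?_ ?_ ?_ ?_
  · simp only [unitPart_mul, h1, h2, h3, h5, dotProduct, map_add, map_mul, map_sum]
  · rw [h2]
    funext i
    simp [mainPart_mul, act_apply, h1, h2, h5, dotProduct, StructDatum.map]
  · rw [h3]
    funext i
    simp [dualPart_mul, form_apply, h1, h2, h3, h4, StructDatum.map]
  · rw [h4]
    funext i
    simp [formPart_mul, h1, h4, StructDatum.map]
  · rw [h5]
    funext i
    simp [opPart_mul, h1, h5, StructDatum.map]

variable {D}

theorem unit_mul : D.mul (unit F d r) x = x := by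
  refine struct_ext ?_ ?_ ?_ ?_ ?_
  · simp [unitPart_mul, unit]
  · simp [mainPart_mul, unit]
  · simp [dualPart_mul, unit]
  · simp [formPart_mul, unit]
  · simp [opPart_mul, unit]

/-- This diagonal operator is what separates the summands, both in ideals and under automorphisms.
-/
theorem mul_unit (hD : D.Nondegenerate) (j : StructIndex d r) :
    D.mul x (unit F d r) j = D.weight j.sort * x j := by
  have h : D.mul x (unit F d r) = structMk (unitPart x) (D.weight (Sum.inl 1) • mainPart x)
      (D.weight (Sum.inl 2) • dualPart x) (D.weight (Sum.inl 3) • formPart x)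
      ((fun i => D.weight (Sum.inr i)) * opPart x) := by
    refine struct_ext ?_ ?_ ?_ ?_ ?_
    · simp [unitPart_mul, unit]
    · simp [mainPart_mul, unit]
    · simp [dualPart_mul, unit]
    · simp [formPart_mul, unit]
    · simp [opPart_mul, unit]
  rw [h]
  rcases j with j | j | j | j | j
  · change x _ = D.weight (Sum.inl 0) * x _
    rw [hD.weight_unit, one_mul]
  all_goals rfl

theorem Nondegenerate.form_injective (hD : D.Nondegenerate) {n : Fin r → F}
    (hn : ∀ m, D.form m n = 0) : n = 0 := by
  obtain ⟨q, hq⟩ := hD.form_separates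
  have h : ∀ i j, ∑ l, n l * D.pair i j l = 0 := by
    intro i j
    have := congrFun (hn (Pi.single i 1)) j
    rw [form_apply] at this
    simpa [Pi.single_apply, Finset.sum_ite_eq'] using this
  funext l
  calc n l = ∑ l', n l' * ∑ i, ∑ j, q l i j * D.pair i j l' := by simp [hq]
    _ = ∑ i, ∑ j, q l i j * ∑ l', n l' * D.pair i j l' := by
      simp only [Finset.mul_sum]
      rw [Finset.sum_comm]
      refine Finset.sum_congr rfl fun i _ => ?_
      rw [Finset.sum_comm]
      exact Finset.sum_congr rfl fun j _ => Finset.sum_congr rfl fun l' _ => mul_left_comm _ _ _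
    _ = 0 := by simp [h]

/-- An ideal is stable under polynomials in right multiplication by `e`, and Lagrange interpolation
at the weights isolates the `e`-coordinate. Any other nonzero component is moved into that
coordinate: `M` and `M*` by each other, `C` by some `c_i`, and `N` through `M*` by an element of
`M`. -/
theorem eq_bot_or_eq_top_of_ideal (hD : D.Nondegenerate) (I : Submodule F (StructIndex d r → F))
    (hI : ∀ a ∈ I, ∀ x, D.mul x a ∈ I ∧ D.mul a x ∈ I) : I = ⊥ ∨ I = ⊤ := by
  classical
  have hpoly : ∀ (p : Polynomial F), ∀ a ∈ I,
      (fun j => p.eval (D.weight (StructIndex.sort j)) * a j) ∈ I := by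
    intro p
    induction p using Polynomial.induction_on' with
    | add p q hp hq =>
      intro a ha
      simp only [Polynomial.eval_add, add_mul]
      exact add_mem (hp a ha) (hq a ha)
    | monomial n c =>
      induction n with
      | zero =>
        intro a ha
        simp only [Polynomial.monomial_zero_left, Polynomial.eval_C]
        exact I.smul_mem c ha
      | succ n ih =>
        intro a ha
        have h1 := ih _ (hI a ha (unit F d r)).2
        simp only [mul_unit a hD] at h1
        simpa [Polynomial.eval_monomial, pow_succ, mul_assoc] using h1
  have hunit : ∀ a ∈ I, unitPart a ≠ 0 → I = ⊤ := by
    intro a ha h0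
    let p := Lagrange.interpolate Finset.univ D.weight fun i => if i = Sum.inl 0 then 1 else 0
    have hp : ∀ i, p.eval (D.weight i) = if i = Sum.inl 0 then 1 else 0 := fun i =>
      Lagrange.eval_interpolate_at_node _ hD.weight_injective.injOn (Finset.mem_univ i)
    have h1 := hpoly p a ha
    have h2 : (fun j => p.eval (D.weight (StructIndex.sort j)) * a j) =
        unitPart a • unit F d r := by
      funext j
      rw [hp]
      rcases j with j | j | j | j | j <;>
        simp [StructIndex.sort, unit, structMk, unitPart]
    rw [h2] at h1
    have h3 : unit F d r ∈ I := by
      have := I.smul_mem (unitPart a)⁻¹ h1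
      rwa [smul_smul, inv_mul_cancel₀ h0, one_smul] at this
    refine (Submodule.eq_top_iff').2 fun x => ?_
    have := (hI _ h3 x).2
    rwa [unit_mul] at this
  by_cases hbot : I = ⊥
  · exact Or.inl hbot
  right
  obtain ⟨a, ha, ha0⟩ := Submodule.exists_mem_ne_zero_of_ne_bot hbot
  have hdual : ∀ a ∈ I, ∀ i, dualPart a i ≠ 0 → I = ⊤ := by
    intro a ha i hi
    refine hunit _ (hI a ha (structMk 0 (Pi.single i 1) 0 0 0)).1 ?_
    simpa [unitPart_mul] using hi
  by_contra htop
  refine ha0 (struct_ext ?_ ?_ ?_ ?_ ?_)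
  · by_contra h
    exact htop (hunit a ha h)
  · funext i
    by_contra h
    refine htop (hunit _ (hI a ha (structMk 0 0 (Pi.single i 1) 0 0)).2 ?_)
    simpa [unitPart_mul] using h
  · funext i
    by_contra h
    exact htop (hdual a ha i h)
  · refine hD.form_injective fun m => ?_
    funext i
    by_contra h
    refine htop (hdual _ (hI a ha (structMk 0 m 0 0 0)).1 i ?_)
    simpa [dualPart_mul] using h
  · funext i
    by_contra h
    refine htop (hunit _ (hI a ha (structMk 0 0 0 0 (Pi.single i 1))).1 ?_)
    simpa [unitPart_mul] using h

theorem isSimpleAlgebra_of_equiv (hD : D.Nondegenerate) {A : Type*} [NonUnitalNonAssocRing A]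
    [Module F A] (e : A ≃ₗ[F] (StructIndex d r → F))
    (he : ∀ x y, e (x * y) = D.mul (e x) (e y)) : IsSimpleAlgebra F A := by
  constructor
  · refine ⟨e.symm (unit F d r), e.symm (unit F d r), fun h => ?_⟩
    have h1 := congrArg e h
    rw [he, LinearEquiv.apply_symm_apply, unit_mul, map_zero] at h1
    have := congrArg unitPart h1
    simp [unit] at this
  · intro I hI
    have h := eq_bot_or_eq_top_of_ideal hD (I.map e.toLinearMap) (by
      rintro _ ⟨a, ha, rfl⟩ x
      obtain ⟨x, rfl⟩ := e.surjective x
      exact ⟨⟨_, (hI a ha x).1, he _ _⟩, ⟨_, (hI a ha x).2, he _ _⟩⟩)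
    rcases h with h | h
    · left
      exact Submodule.map_eq_bot_iff.1 h
    · right
      refine Submodule.eq_top_iff'.2 fun a => ?_
      have : e a ∈ I.map e.toLinearMap := h ▸ Submodule.mem_top
      obtain ⟨b, hb, hba⟩ := this
      rwa [← e.injective hba]

end StructDatum

end StructureAlgebra

/-! ### Automorphisms of the structure algebra. -/

section StructureAutomorphisms

namespace StructDatum

variable {F : Type*} [Field F] {d r : ℕ}

/-- The block-diagonal endomorphism that fixes the left identity and the operators. -/
def blockEnd (gm gd : Module.End F (Fin d → F)) (gn : Module.End F (Fin r → F)) :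
    Module.End F (StructIndex d r → F) where
  toFun x := structMk (unitPart x) (gm (mainPart x)) (gd (dualPart x)) (gn (formPart x)) (opPart x)
  map_add' x y := by rw [structMk_add]; simp only [map_add]
  map_smul' t x := by simp only [map_smul, RingHom.id_apply, smul_structMk, smul_eq_mul]

theorem blockEnd_apply (gm gd : Module.End F (Fin d → F)) (gn : Module.End F (Fin r → F))
    (x : StructIndex d r → F) : blockEnd gm gd gn x =
      structMk (unitPart x) (gm (mainPart x)) (gd (dualPart x)) (gn (formPart x)) (opPart x) := rfl

theorem blockEnd_one : blockEnd (1 : Module.End F (Fin d → F)) 1 (1 : Module.End F (Fin r → F)) =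
    1 :=
  LinearMap.ext fun x => structMk_parts x

theorem blockEnd_mul (gm gm' gd gd' : Module.End F (Fin d → F))
    (gn gn' : Module.End F (Fin r → F)) :
    blockEnd (gm * gm') (gd * gd') (gn * gn') = blockEnd gm gd gn * blockEnd gm' gd' gn' := rfl

/-- The inclusion of `M`. -/
def mainIncl : (Fin d → F) →ₗ[F] (StructIndex d r → F) where
  toFun m := structMk 0 m 0 0 0
  map_add' m m' := by rw [structMk_add]; simp
  map_smul' t m := by rw [RingHom.id_apply, smul_structMk]; simp

/-- The block of an endomorphism on `M`. -/
def mainBlock (g : (StructIndex d r → F) ≃ₗ[F] (StructIndex d r → F)) :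
    Module.End F (Fin d → F) :=
  mainPart ∘ₗ g.toLinearMap ∘ₗ mainIncl

variable {D : StructDatum F d r}

theorem blockEnd_map_mul {gm gd : Module.End F (Fin d → F)} {gn : Module.End F (Fin r → F)}
    (hdot : ∀ m m', gm m ⬝ᵥ gd m' = m ⬝ᵥ m') (hact : ∀ m c, D.act (gm m) c = gm (D.act m c))
    (hform : ∀ m n, D.form (gm m) (gn n) = gd (D.form m n)) (hvec : gm D.vec = D.vec)
    (x y : StructIndex d r → F) :
    blockEnd gm gd gn (D.mul x y) = D.mul (blockEnd gm gd gn x) (blockEnd gm gd gn y) := by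
  refine struct_ext ?_ ?_ ?_ ?_ ?_
  · simp [blockEnd_apply, unitPart_mul, hdot]
  · simp [blockEnd_apply, mainPart_mul, hact, hvec]
  · simp [blockEnd_apply, dualPart_mul, hform]
  · simp [blockEnd_apply, formPart_mul]
  · simp [blockEnd_apply, opPart_mul]

theorem mul_main_dual (m m' : Fin d → F) :
    D.mul (structMk 0 m 0 0 0) (structMk 0 0 m' 0 0) = (m ⬝ᵥ m') • unit F d r := by
  refine struct_ext ?_ ?_ ?_ ?_ ?_ <;>
    simp [unitPart_mul, mainPart_mul, dualPart_mul, formPart_mul, opPart_mul, unit]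

theorem mul_main_form (m : Fin d → F) (n : Fin r → F) :
    D.mul (structMk 0 m 0 0 0) (structMk 0 0 0 n 0) = structMk 0 0 (D.form m n) 0 0 := by
  refine struct_ext ?_ ?_ ?_ ?_ ?_ <;>
    simp [unitPart_mul, mainPart_mul, dualPart_mul, formPart_mul, opPart_mul]

theorem mul_main_op (m c : Fin d → F) :
    D.mul (structMk 0 m 0 0 0) (structMk 0 0 0 0 c) = structMk 0 (D.act m c) 0 0 0 := by
  refine struct_ext ?_ ?_ ?_ ?_ ?_ <;>
    simp [unitPart_mul, mainPart_mul, dualPart_mul, formPart_mul, opPart_mul]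

theorem mul_op_op (c c' : Fin d → F) :
    D.mul (structMk 0 0 0 0 c) (structMk 0 0 0 0 c') =
      structMk (c ⬝ᵥ c') ((c ⬝ᵥ c') • D.vec) 0 0 (c * c') := by
  refine struct_ext ?_ ?_ ?_ ?_ ?_ <;>
    simp [unitPart_mul, mainPart_mul, dualPart_mul, formPart_mul, opPart_mul]

section Automorphism

variable (hD : D.Nondegenerate) {g : (StructIndex d r → F) ≃ₗ[F] (StructIndex d r → F)}
  (hg : ∀ x y, g (D.mul x y) = D.mul (g x) (g y))

include hD hg

/-- Any left identity `u` satisfies `u e = e`; right multiplication by `e` is diagonal and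
invertible with eigenvalue 1 at `e`, so `u = e`. -/
theorem aut_unit : g (unit F d r) = unit F d r := by
  have h1 : ∀ x, D.mul (g (unit F d r)) x = x := by
    intro x
    obtain ⟨x, rfl⟩ := g.surjective x
    rw [← hg, unit_mul]
  have h2 := h1 (unit F d r)
  funext j
  have h3 := congrFun h2 j
  rw [mul_unit _ hD] at h3
  rcases j with j | j | j | j | j
  · change D.weight (Sum.inl 0) * _ = _ at h3
    rwa [hD.weight_unit, one_mul] at h3
  all_goals exact (mul_eq_zero.1 h3).resolve_left (hD.weight_ne_zero _)

/-- As `e` is fixed, `g` commutes with right multiplication by `e` and preserves its eigenspaces. -/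
theorem aut_apply_eq_zero {σ : Fin 4 ⊕ Fin d} {x : StructIndex d r → F}
    (hx : ∀ j, StructIndex.sort j ≠ σ → x j = 0) {j : StructIndex d r}
    (hj : StructIndex.sort j ≠ σ) : g x j = 0 := by
  have h1 : D.mul x (unit F d r) = D.weight σ • x := by
    funext j
    rw [mul_unit _ hD]
    by_cases h : StructIndex.sort j = σ
    · rw [h]; rfl
    · simp [hx j h]
  have h2 := congrFun (hg x (unit F d r)) j
  rw [aut_unit hD hg, h1, map_smul, mul_unit _ hD, Pi.smul_apply, smul_eq_mul] at h2
  by_contra h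
  exact hj (hD.weight_injective (mul_right_cancel₀ h h2).symm)

theorem aut_main (m : Fin d → F) :
    g (structMk 0 m 0 0 0) = structMk 0 (mainBlock g m) 0 0 0 := by
  have h := fun j => aut_apply_eq_zero hD hg (σ := Sum.inl 1) (x := structMk 0 m 0 0 0)
    (by rintro (j | j | j | j | j) h <;> first | rfl | exact absurd rfl h) (j := j)
  funext j
  rcases j with j | j | j | j | j <;>
    first | rfl | exact h _ (by simp [StructIndex.sort])

theorem aut_dual (m : Fin d → F) :
    g (structMk 0 0 m 0 0) = structMk 0 0 (dualPart (g (structMk 0 0 m 0 0))) 0 0 := by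
  have h := fun j => aut_apply_eq_zero hD hg (σ := Sum.inl 2) (x := structMk 0 0 m 0 0)
    (by rintro (j | j | j | j | j) h <;> first | rfl | exact absurd rfl h) (j := j)
  funext j
  rcases j with j | j | j | j | j <;>
    first | rfl | exact h _ (by simp [StructIndex.sort])

theorem aut_form (n : Fin r → F) :
    g (structMk 0 0 0 n 0) = structMk 0 0 0 (formPart (g (structMk 0 0 0 n 0))) 0 := by
  have h := fun j => aut_apply_eq_zero hD hg (σ := Sum.inl 3) (x := structMk 0 0 0 n 0)
    (by rintro (j | j | j | j | j) h <;> first | rfl | exact absurd rfl h) (j := j)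
  funext j
  rcases j with j | j | j | j | j <;>
    first | rfl | exact h _ (by simp [StructIndex.sort])

/-- The eigenspace of `c_i` is a line, so `g c_i = t c_i`. Applying `g` to `c_i² = e + vec + c_i`
gives `t² = 1` at `e` and `t² = t` at `c_i`, hence `t = 1`; the `M`-component then shows that `vec`
is fixed. -/
theorem aut_op_single (i : Fin d) :
    g (structMk 0 0 0 0 (Pi.single i 1)) = structMk 0 0 0 0 (Pi.single i 1) ∧
      g (structMk 0 D.vec 0 0 0) = structMk 0 D.vec 0 0 0 := by
  have h := fun j => aut_apply_eq_zero hD hg (σ := Sum.inr i)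
    (x := structMk 0 0 0 0 (Pi.single i 1)) (by
      rintro (j | j | j | j | j) h
      any_goals rfl
      exact Pi.single_eq_of_ne (fun h' => h (congrArg Sum.inr h')) 1) (j := j)
  obtain ⟨t, ht⟩ : ∃ t : F, g (structMk 0 0 0 0 (Pi.single i 1)) =
      t • structMk 0 0 0 0 (Pi.single i 1) := by
    refine ⟨opPart (g (structMk 0 0 0 0 (Pi.single i 1))) i, ?_⟩
    funext j
    rcases j with j | j | j | j | j
    rotate_left 4
    · by_cases hj : j = i
      · subst hj
        simp [structMk, opPart, LinearMap.funLeft_apply]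
      · refine (h (Sum.inr (Sum.inr (Sum.inr (Sum.inr j)))) fun h' => hj ?_).trans ?_
        · exact Sum.inr_injective h'
        · simp [structMk, hj]
    all_goals
      refine (h _ (by simp [StructIndex.sort])).trans ?_
      simp [structMk]
  have h1 : D.mul (structMk 0 0 0 0 (Pi.single i 1)) (structMk 0 0 0 0 (Pi.single i 1)) =
      unit F d r + structMk 0 D.vec 0 0 0 + structMk 0 0 0 0 (Pi.single i 1) := by
    rw [mul_op_op]
    refine struct_ext ?_ ?_ ?_ ?_ ?_ <;> simp [unit]
    rw [← Pi.single_mul, one_mul]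
  have h2 := hg (structMk 0 0 0 0 (Pi.single i 1)) (structMk 0 0 0 0 (Pi.single i 1))
  rw [h1, map_add, map_add, ht, map_smul, map_smul, LinearMap.smul_apply, h1, aut_unit hD hg,
    aut_main hD hg] at h2
  have h3 := congrArg unitPart h2
  have h4 := congrFun (congrArg opPart h2) i
  have h5 := congrArg mainPart h2
  simp [unit] at h3 h4 h5
  have h6 : t = 1 := by
    rw [h4, ← h3]
  subst h6
  refine ⟨by rw [ht, one_smul], ?_⟩
  rw [aut_main hD hg, h5]
  simp

/-- Invariance of `vec` is read off from the square of some `c_i`, so at least one must exist. -/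
theorem aut_vec (hd : 0 < d) : mainBlock g D.vec = D.vec := by
  have h := (aut_op_single hD hg ⟨0, hd⟩).2
  rw [aut_main hD hg] at h
  exact congrArg mainPart h

theorem aut_op (c : Fin d → F) : g (structMk 0 0 0 0 c) = structMk 0 0 0 0 c := by
  have h : structMk 0 0 0 0 c =
      ∑ i, c i • (structMk 0 0 0 0 (Pi.single i 1) : StructIndex d r → F) := by
    refine struct_ext ?_ ?_ ?_ ?_ ?_ <;> simp
    funext i
    simp [Finset.sum_apply, Pi.single_apply]
  rw [h, map_sum]
  exact Finset.sum_congr rfl fun i _ => by rw [map_smul, (aut_op_single hD hg i).1]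

theorem aut_act (m c : Fin d → F) : mainBlock g (D.act m c) = D.act (mainBlock g m) c := by
  have h := hg (structMk 0 m 0 0 0) (structMk 0 0 0 0 c)
  rw [mul_main_op, aut_op hD hg, aut_main hD hg, aut_main hD hg, mul_main_op] at h
  exact congrArg mainPart h

theorem aut_dotProduct (m m' : Fin d → F) :
    mainBlock g m ⬝ᵥ dualPart (g (structMk 0 0 m' 0 0)) = m ⬝ᵥ m' := by
  have h := hg (structMk 0 m 0 0 0) (structMk 0 0 m' 0 0)
  rw [mul_main_dual, map_smul, aut_unit hD hg, aut_main hD hg, aut_dual hD hg, mul_main_dual] at h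
  have := congrArg unitPart h
  simpa [unit] using this.symm

theorem aut_form_apply (m : Fin d → F) (n : Fin r → F) :
    dualPart (g (structMk 0 0 (D.form m n) 0 0)) =
      D.form (mainBlock g m) (formPart (g (structMk 0 0 0 n 0))) := by
  have h := hg (structMk 0 m 0 0 0) (structMk 0 0 0 n 0)
  rw [mul_main_form, aut_main hD hg, aut_form hD hg, mul_main_form] at h
  exact congrArg dualPart h

theorem aut_main_injective : Function.Injective (mainBlock g) := by
  intro m m' h
  have h1 := aut_main hD hg m
  rw [h, ← aut_main hD hg m'] at h1
  exact congrArg mainPart (g.injective h1)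

/-- The trilinear form is the `e`-coordinate of `m' (m n)`. -/
theorem aut_trilinear (m m' : Fin d → F) (n : Fin r → F) :
    mainBlock g m' ⬝ᵥ D.form (mainBlock g m) (formPart (g (structMk 0 0 0 n 0))) =
      m' ⬝ᵥ D.form m n := by
  rw [← aut_form_apply hD hg, aut_dotProduct hD hg]

theorem aut_form_surjective (n : Fin r → F) : ∃ n', formPart (g (structMk 0 0 0 n' 0)) = n := by
  have hg' : ∀ x y, g.symm (D.mul x y) = D.mul (g.symm x) (g.symm y) := by
    intro x y
    apply g.injective
    rw [hg]
    simp only [LinearEquiv.apply_symm_apply]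
  refine ⟨formPart (g.symm (structMk 0 0 0 n 0)), ?_⟩
  rw [← aut_form hD hg', LinearEquiv.apply_symm_apply]
  rfl

/-- Automorphisms preserve all relations between products that are detected by `N`. -/
theorem aut_trilinear_congr {m₁ m₁' m₂ m₂' : Fin d → F}
    (h : ∀ n, m₁' ⬝ᵥ D.form m₁ n = m₂' ⬝ᵥ D.form m₂ n) (n : Fin r → F) :
    mainBlock g m₁' ⬝ᵥ D.form (mainBlock g m₁) n =
      mainBlock g m₂' ⬝ᵥ D.form (mainBlock g m₂) n := by
  obtain ⟨n, rfl⟩ := aut_form_surjective hD hg n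
  rw [aut_trilinear hD hg, aut_trilinear hD hg, h]

/-- Triviality on `M` passes to `M*` by nondegeneracy of the pairing, then to `N` by
`form_injective`; `e` and `C` are always fixed. -/
theorem aut_eq_refl (h : ∀ m, mainBlock g m = m) (x : StructIndex d r → F) : g x = x := by
  have hmain : ∀ m, g (structMk 0 m 0 0 0) = structMk 0 m 0 0 0 := fun m => by
    rw [aut_main hD hg, h]
  have hdual' : ∀ m, dualPart (g (structMk 0 0 m 0 0)) = m := by
    intro m
    refine dotProduct_eq _ _ fun m' => ?_
    have := aut_dotProduct hD hg m' m
    rwa [h, dotProduct_comm, dotProduct_comm m'] at this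
  have hdual : ∀ m, g (structMk 0 0 m 0 0) = structMk 0 0 m 0 0 := fun m => by
    rw [aut_dual hD hg, hdual']
  have hform : ∀ n, g (structMk 0 0 0 n 0) = structMk 0 0 0 n 0 := by
    intro n
    rw [aut_form hD hg]
    congr 1
    refine sub_eq_zero.1 (hD.form_injective fun m => ?_)
    have := aut_form_apply hD hg m n
    rw [hdual', h] at this
    rw [map_sub, ← this, sub_self]
  have hx : x = unitPart x • unit F d r + structMk 0 (mainPart x) 0 0 0 +
      structMk 0 0 (dualPart x) 0 0 + structMk 0 0 0 (formPart x) 0 +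
      structMk 0 0 0 0 (opPart x) := by
    refine struct_ext ?_ ?_ ?_ ?_ ?_ <;> simp [unit]
  conv_lhs => rw [hx]
  simp only [map_add, map_smul]
  rw [aut_unit hD hg, hmain, hdual, hform, aut_op hD hg, ← hx]

end Automorphism

end StructDatum

end StructureAutomorphisms

/-! ### Contragredient representations and coordinates of functions. -/

section Contragredient

variable {K : Type*} [Field K] {G : Type*} [Group G] {ι : Type*} [Fintype ι] [DecidableEq ι]

/-- The contragredient of a matrix representation. -/
def contragredient (ρ : G →* Matrix ι ι K) : G →* Matrix ι ι K where
  toFun x := (ρ x⁻¹).transpose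
  map_one' := by simp
  map_mul' x y := by rw [mul_inv_rev, map_mul, Matrix.transpose_mul]

theorem contragredient_apply (ρ : G →* Matrix ι ι K) (x : G) :
    contragredient ρ x = (ρ x⁻¹).transpose := rfl

theorem dotProduct_contragredient (ρ : G →* Matrix ι ι K) (x : G) (a b : ι → K) :
    a ⬝ᵥ (contragredient ρ x).mulVec b = (ρ x⁻¹).mulVec a ⬝ᵥ b := by
  rw [contragredient_apply, Matrix.dotProduct_mulVec, Matrix.vecMul_transpose]

theorem inv_mulVec_mulVec (ρ : G →* Matrix ι ι K) (x : G) (a : ι → K) :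
    (ρ x⁻¹).mulVec ((ρ x).mulVec a) = a := by
  rw [Matrix.mulVec_mulVec, ← map_mul, inv_mul_cancel, map_one, Matrix.one_mulVec]

theorem mulVec_inv_mulVec (ρ : G →* Matrix ι ι K) (x : G) (a : ι → K) :
    (ρ x).mulVec ((ρ x⁻¹).mulVec a) = a := by
  rw [Matrix.mulVec_mulVec, ← map_mul, mul_inv_cancel, map_one, Matrix.one_mulVec]

/-- A matrix representation as a representation on `ι → K`. -/
def matrixRep (ρ : G →* Matrix ι ι K) : G →* Module.End K (ι → K) :=
  (Matrix.toLinAlgEquiv' : Matrix ι ι K ≃ₐ[K] _).toAlgHom.toMonoidHom.comp ρ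

theorem matrixRep_apply (ρ : G →* Matrix ι ι K) (x : G) (a : ι → K) :
    matrixRep ρ x a = (ρ x).mulVec a := by
  simp [matrixRep]

end Contragredient

section LinearCombination

variable {K X : Type*} [Field K]

theorem lc_apply {ι : Type*} [Fintype ι] (b : ι → X → K) (m : ι → K) (x : X) :
    Fintype.linearCombination K b m x = ∑ i, m i * b i x := by
  simp [Fintype.linearCombination_apply, Finset.sum_apply]

theorem lc_injective {ι : Type*} [Fintype ι] {b : ι → X → K} (hb : LinearIndependent K b) :
    Function.Injective (Fintype.linearCombination K b) :=
  hb.fintypeLinearCombination_injective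

theorem lc_translation {G : Type*} [Group G] {ι : Type*} [Fintype ι] [DecidableEq ι]
    {b : ι → G → K} {ρ : G →* Matrix ι ι K} (hρ : ∀ i x y, b i (x * y) = ∑ j, b j x * ρ y j i)
    (m : ι → K) (x y : G) : Fintype.linearCombination K b ((ρ x).mulVec m) y =
      Fintype.linearCombination K b m (y * x) := by
  simp only [lc_apply, hρ, Matrix.mulVec, dotProduct, Finset.sum_mul, Finset.mul_sum]
  rw [Finset.sum_comm]
  exact Finset.sum_congr rfl fun i _ => Finset.sum_congr rfl fun j _ => by ring

end LinearCombination

/-- When the datum comes from functions, the vector paired with `n` is the coordinate vector of the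
product of `m` and `m'` (`lc_mul`), so `N` acts as the dual of `M·M`. -/
theorem StructDatum.dotProduct_form {k K : Type*} [Field k] [Field K] [Algebra k K] {d r : ℕ}
    (D : StructDatum k d r) (m m' : Fin d → K) (n : Fin r → K) :
    m' ⬝ᵥ (D.map (algebraMap k K)).form m n =
      (fun l => ∑ i, ∑ j, m i * m' j * algebraMap k K (D.pair i j l)) ⬝ᵥ n := by
  simp only [dotProduct, StructDatum.form_apply, StructDatum.map, Finset.mul_sum, Finset.sum_mul]
  conv_rhs => rw [Finset.sum_comm]
  rw [Finset.sum_comm]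
  refine Finset.sum_congr rfl fun i _ => ?_
  conv_rhs => rw [Finset.sum_comm]
  refine Finset.sum_congr rfl fun j _ => Finset.sum_congr rfl fun l _ => ?_
  ring

/-! ### The datum attached to a space of functions, and its symmetry under right translations. -/

section FunctionDatum

variable {k : Type*} [Field k] {K : Type*} [Field K] [Algebra k K] {G : Type*} [Group G]
  {R : Subalgebra k (G → K)} {d r : ℕ}

/-- `b` is a basis of a space of regular functions that contains the constants and is stable under
the comultiplication, `w` is a basis of the span of the products of its elements, and `D` consists
of the corresponding structure constants. -/
structure FunctionDatum (R : Subalgebra k (G → K)) (D : StructDatum k d r)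
    (b : Fin d → G → K) (w : Fin r → G → K) : Prop where
  mem : ∀ i, b i ∈ R
  indep : LinearIndependent K b
  prod_indep : LinearIndependent K w
  vec_eq : ∑ i, D.vec i • b i = 1
  -- The first index of `op` belongs to the left factor `x`: the operators are coefficients of left
  -- translations and therefore commute with right translations.
  comul_eq : ∀ i x y, b i (x * y) = ∑ j, ∑ l, D.op j i l • (b j x * b l y)
  pair_eq : ∀ i j, b i * b j = ∑ l, D.pair i j l • w l
  -- `q` lifts a basis of `M·M` to `M ⊗ M` over `k`, which supplies `form_separates`.
  prod_eq : ∃ q : Fin r → Fin d → Fin d → k, (∀ l, w l = ∑ i, ∑ j, q l i j • (b i * b j)) ∧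
    ∀ l l', ∑ i, ∑ j, q l i j * D.pair i j l' = if l = l' then 1 else 0

namespace FunctionDatum

variable {D : StructDatum k d r} {b : Fin d → G → K} {w : Fin r → G → K}

variable (h : FunctionDatum R D b w)

include h

theorem lc_vec : Fintype.linearCombination K b (D.map (algebraMap k K)).vec = 1 := by
  rw [← h.vec_eq, Fintype.linearCombination_apply]
  exact Finset.sum_congr rfl fun i _ => algebraMap_smul K _ _

theorem lc_comul (m : Fin d → K) (x y : G) : Fintype.linearCombination K b m (x * y) =
    ∑ j, b j x * Fintype.linearCombination K b
      ((D.map (algebraMap k K)).act m (Pi.single j 1)) y := by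
  simp only [lc_apply, StructDatum.act_apply, h.comul_eq, Finset.mul_sum, Finset.sum_mul]
  rw [Finset.sum_comm]
  refine Finset.sum_congr rfl fun j _ => ?_
  rw [Finset.sum_comm]
  refine Finset.sum_congr rfl fun l _ => Finset.sum_congr rfl fun i _ => ?_
  rw [Finset.sum_eq_single j]
  · simp only [StructDatum.map, Pi.single_eq_same, Algebra.smul_def]
    ring
  · intro j' _ hj'
    simp [hj']
  · simp

theorem eq_of_sum_eq {ι : Type*} {v v' : Fin d → ι → K}
    (hv : ∀ x i, ∑ j, b j x * v j i = ∑ j, b j x * v' j i) : v = v' := by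
  funext j i
  refine congrFun (lc_injective h.indep (a₁ := fun j => v j i) (a₂ := fun j => v' j i) ?_) j
  funext x
  rw [lc_apply, lc_apply]
  simpa only [mul_comm] using hv x i

/-- The coordinates of a product of two elements of `M`. -/
theorem lc_mul (m m' : Fin d → K) :
    Fintype.linearCombination K b m * Fintype.linearCombination K b m' =
    Fintype.linearCombination K w fun l =>
      ∑ i, ∑ j, m i * m' j * algebraMap k K (D.pair i j l) := by
  funext x
  rw [Pi.mul_apply, lc_apply, lc_apply, lc_apply, Finset.sum_mul_sum]
  simp only [Finset.sum_mul]
  conv_rhs => rw [Finset.sum_comm]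
  refine Finset.sum_congr rfl fun i _ => ?_
  conv_rhs => rw [Finset.sum_comm]
  refine Finset.sum_congr rfl fun j _ => ?_
  have := congrFun (h.pair_eq i j) x
  rw [Pi.mul_apply, Finset.sum_apply] at this
  rw [mul_mul_mul_comm, this, Finset.mul_sum]
  refine Finset.sum_congr rfl fun l _ => ?_
  rw [Pi.smul_apply, Algebra.smul_def]
  ring

/-- Right translations act on `M` through regular matrices. -/
theorem exists_mainRep : ∃ ρ : G →* Matrix (Fin d) (Fin d) K,
    (∀ i j, (fun x => ρ x i j) ∈ R) ∧ ∀ i x y, b i (x * y) = ∑ j, b j x * ρ y j i := by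
  let c : Fin d → Fin d → G → K := fun j i => ∑ l, D.op j i l • b l
  have hc : ∀ i x y, b i (x * y) = ∑ j, b j x * c j i y := by
    intro i x y
    rw [h.comul_eq]
    refine Finset.sum_congr rfl fun j _ => ?_
    simp only [c, Finset.sum_apply, Pi.smul_apply, Finset.mul_sum, mul_smul_comm]
  obtain ⟨ρ, hρ⟩ := exists_translationMatrix h.indep hc
  refine ⟨ρ, fun i j => ?_, fun i x y => ?_⟩
  · have : (fun x => ρ x i j) = c i j := funext fun x => hρ x i j
    rw [this]
    exact sum_mem fun l _ => Subalgebra.smul_mem _ (h.mem l) _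
  · simp only [hρ, hc]

/-- Right translations act on the span of the products through regular matrices. -/
theorem exists_prodRep : ∃ σ : G →* Matrix (Fin r) (Fin r) K,
    (∀ i j, (fun x => σ x i j) ∈ R) ∧ ∀ i x y, w i (x * y) = ∑ j, w j x * σ y j i := by
  let M := Submodule.span k (Set.range b)
  let W := Submodule.span k (Set.range w)
  have hM : ∀ i, comul k K G (b i) ∈ boxProd M R.toSubmodule := by
    intro i
    have : comul k K G (b i) = ∑ j, ∑ l, D.op j i l • fun p : G × G => b j p.1 * b l p.2 := by
      funext p
      simp only [comul_apply, h.comul_eq, Finset.sum_apply, Pi.smul_apply]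
    rw [this]
    exact sum_mem fun j _ => sum_mem fun l _ => Submodule.smul_mem _ _
      (mul_mem_boxProd (Submodule.subset_span ⟨j, rfl⟩) (N := R.toSubmodule) (h.mem l))
  have hMM : M * M ≤ W := by
    rw [Submodule.span_mul_span, Submodule.span_le]
    rintro _ ⟨_, ⟨i, rfl⟩, _, ⟨j, rfl⟩, rfl⟩
    change b i * b j ∈ W
    rw [h.pair_eq]
    exact sum_mem fun l _ => Submodule.smul_mem _ _ (Submodule.subset_span ⟨l, rfl⟩)
  have hRR : R.toSubmodule * R.toSubmodule ≤ R.toSubmodule :=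
    Submodule.mul_le.2 fun a ha b hb => mul_mem (S := Subalgebra k (G → K)) ha hb
  have hbox : boxProd M R.toSubmodule * boxProd M R.toSubmodule ≤ boxProd W R.toSubmodule := by
    refine le_trans (le_of_eq ?_) (boxProd_mono hMM hRR)
    simp only [boxProd, Submodule.map_mul]
    exact mul_mul_mul_comm _ _ _ _
  obtain ⟨q, hq, -⟩ := h.prod_eq
  have hW : ∀ l, comul k K G (w l) ∈ boxProd W R.toSubmodule := by
    intro l
    rw [hq]
    simp only [map_sum, map_smul, map_mul]
    exact sum_mem fun i _ => sum_mem fun j _ => Submodule.smul_mem _ _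
      (hbox (Submodule.mul_mem_mul (hM i) (hM j)))
  choose c hcR hc using fun l => boxProd_span_left R.toSubmodule w (hW l)
  obtain ⟨σ, hσ⟩ := exists_translationMatrix h.prod_indep (c := fun j i => c i j) hc
  refine ⟨σ, fun i j => ?_, fun i x y => ?_⟩
  · have : (fun x => σ x i j) = c j i := funext fun x => hσ x i j
    rw [this]
    exact hcR j i
  · simp only [hσ]
    exact hc i x y

section Equivariance

variable {ρ : G →* Matrix (Fin d) (Fin d) K} (hρ : ∀ i x y, b i (x * y) = ∑ j, b j x * ρ y j i)

include hρ

theorem mulVec_vec (x : G) : (ρ x).mulVec (D.map (algebraMap k K)).vec =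
    (D.map (algebraMap k K)).vec := by
  refine lc_injective h.indep (funext fun y => ?_)
  rw [lc_translation hρ, h.lc_vec]
  rfl

/-- Left and right translations commute: the coefficients of `b j z` in `m (z * y * x)` are compared
for the two bracketings. -/
theorem act_mulVec (x : G) (m c : Fin d → K) :
    (D.map (algebraMap k K)).act ((ρ x).mulVec m) c =
      (ρ x).mulVec ((D.map (algebraMap k K)).act m c) := by
  have h1 : ∀ j, (D.map (algebraMap k K)).act ((ρ x).mulVec m) (Pi.single j 1) =
      (ρ x).mulVec ((D.map (algebraMap k K)).act m (Pi.single j 1)) := by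
    intro j
    refine lc_injective h.indep ?_
    refine congrFun (h.eq_of_sum_eq (v := fun j => Fintype.linearCombination K b
      ((D.map (algebraMap k K)).act ((ρ x).mulVec m) (Pi.single j 1)))
      (v' := fun j => Fintype.linearCombination K b
        ((ρ x).mulVec ((D.map (algebraMap k K)).act m (Pi.single j 1)))) fun z y => ?_) j
    rw [← h.lc_comul, lc_translation hρ]
    simp only [lc_translation hρ]
    rw [← h.lc_comul, mul_assoc]
  have h2 : (D.map (algebraMap k K)).act ((ρ x).mulVec m) =
      (ρ x).mulVecLin ∘ₗ (D.map (algebraMap k K)).act m :=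
    (Pi.basisFun K (Fin d)).ext fun j => by simpa using h1 j
  exact LinearMap.congr_fun h2 c

/-- Pairing with an arbitrary `m'` reduces the claim to multiplicativity of right translation, `hp`.
-/
theorem form_mulVec {σ : G →* Matrix (Fin r) (Fin r) K}
    (hσ : ∀ i x y, w i (x * y) = ∑ j, w j x * σ y j i) (x : G) (m : Fin d → K) (n : Fin r → K) :
    (D.map (algebraMap k K)).form ((ρ x).mulVec m) ((contragredient σ x).mulVec n) =
      (contragredient ρ x).mulVec ((D.map (algebraMap k K)).form m n) := by
  let p : (Fin d → K) → (Fin d → K) → Fin r → K := fun m m' l =>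
    ∑ i, ∑ j, m i * m' j * algebraMap k K (D.pair i j l)
  have hp : ∀ m m', p ((ρ x).mulVec m) ((ρ x).mulVec m') = (σ x).mulVec (p m m') := by
    intro m m'
    refine lc_injective h.prod_indep (funext fun y => ?_)
    rw [lc_translation hσ, ← h.lc_mul, ← h.lc_mul, Pi.mul_apply, Pi.mul_apply,
      lc_translation hρ, lc_translation hρ]
  refine dotProduct_eq _ _ fun m' => ?_
  rw [dotProduct_comm, dotProduct_comm _ m', D.dotProduct_form, dotProduct_contragredient,
    dotProduct_contragredient, D.dotProduct_form]
  change (σ x⁻¹).mulVec (p _ _) ⬝ᵥ n = p _ _ ⬝ᵥ n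
  conv_lhs => rw [← mulVec_inv_mulVec ρ x m', hp, inv_mulVec_mulVec]

end Equivariance

end FunctionDatum

end FunctionDatum

/-! ### The structure algebra as a type, and its base change. -/

section StructAlgebra

/-- The algebra with structure constants given by the datum `D`. -/
def StructDatum.Alg {F : Type*} [Field F] {d r : ℕ} (_ : StructDatum F d r) : Type _ :=
  StructIndex d r → F

namespace StructDatum

variable {F : Type*} [Field F] {d r : ℕ} (D : StructDatum F d r)

instance : AddCommGroup D.Alg := inferInstanceAs (AddCommGroup (StructIndex d r → F))

instance : Module F D.Alg := inferInstanceAs (Module F (StructIndex d r → F))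

instance : NonUnitalNonAssocRing D.Alg where
  mul x y := D.mul x y
  left_distrib x y z := map_add (D.mul x) y z
  right_distrib x y z := LinearMap.congr_fun (map_add D.mul x y) z
  zero_mul x := LinearMap.congr_fun (map_zero D.mul) x
  mul_zero x := map_zero (D.mul x)

instance : SMulCommClass F D.Alg D.Alg where
  smul_comm t x y := (map_smul (D.mul x) t y).symm

instance : IsScalarTower F D.Alg D.Alg where
  smul_assoc t x y := LinearMap.congr_fun (map_smul D.mul t x) y

/-- The coordinates of the elements of the structure algebra. -/
def coord : D.Alg ≃ₗ[F] (StructIndex d r → F) := LinearEquiv.refl F (StructIndex d r → F)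

theorem coord_mul (x y : D.Alg) : D.coord (x * y) = D.mul (D.coord x) (D.coord y) := rfl

/-- The basis of the structure algebra. -/
noncomputable def basis : Module.Basis (StructIndex d r) F D.Alg := Module.Basis.ofEquivFun D.coord

theorem basis_repr (x : D.Alg) (j : StructIndex d r) : D.basis.repr x j = D.coord x j := rfl

instance : Module.Finite F D.Alg := Module.Finite.of_basis D.basis

/-- The coordinates after a change of scalars. -/
noncomputable def coordBaseChange (K : Type*) [Field K] [Algebra F K] :
    K ⊗[F] D.Alg ≃ₗ[K] (StructIndex d r → K) :=
  (D.basis.baseChange K).equivFun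

theorem coordBaseChange_tmul {K : Type*} [Field K] [Algebra F K] (a : K) (x : D.Alg) :
    D.coordBaseChange K (a ⊗ₜ[F] x) = a • fun j => algebraMap F K (D.coord x j) := by
  funext j
  simp [coordBaseChange, basis_repr, Algebra.smul_def, mul_comm]

theorem coordBaseChange_mul {K : Type*} [Field K] [Algebra F K] (x y : K ⊗[F] D.Alg) :
    D.coordBaseChange K (x * y) =
      (D.map (algebraMap F K)).mul (D.coordBaseChange K x) (D.coordBaseChange K y) := by
  induction x using TensorProduct.induction_on with
  | zero => rw [zero_mul, map_zero, map_zero, LinearMap.zero_apply]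
  | add x x' hx hx' => rw [add_mul, map_add, map_add, map_add, hx, hx', LinearMap.add_apply]
  | tmul a x =>
    induction y using TensorProduct.induction_on with
    | zero => rw [mul_zero, map_zero, map_zero]
    | add y y' hy hy' => rw [mul_add, map_add, map_add, map_add, hy, hy']
    | tmul c y =>
      rw [Algebra.TensorProduct.tmul_mul_tmul, coordBaseChange_tmul, coordBaseChange_tmul,
        coordBaseChange_tmul, map_smul, map_smul, LinearMap.smul_apply, map_mul_map, coord_mul,
        smul_smul, mul_comm]

variable {D}

theorem isSimpleAlgebra (hD : D.Nondegenerate) : IsSimpleAlgebra F D.Alg :=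
  isSimpleAlgebra_of_equiv hD D.coord D.coord_mul

theorem isSimpleAlgebra_baseChange (hD : D.Nondegenerate) (K : Type*) [Field K] [Algebra F K] :
    IsSimpleAlgebra K (K ⊗[F] D.Alg) :=
  isSimpleAlgebra_of_equiv (hD.map (algebraMap F K)) (D.coordBaseChange K) D.coordBaseChange_mul

end StructDatum

end StructAlgebra

/-! ### The action of `G` on the structure algebra and its image. -/

section Realization

variable {k : Type*} [Field k] {K : Type*} [Field K] [Algebra k K] {G : Type*} [Group G]
  {R : Subalgebra k (G → K)} {d r : ℕ} {D : StructDatum k d r} {b : Fin d → G → K}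
  {w : Fin r → G → K}

/-- The representation of `G` on the structure algebra. -/
def structRep (ρ : G →* Matrix (Fin d) (Fin d) K) (σ : G →* Matrix (Fin r) (Fin r) K) :
    G →* Module.End K (StructIndex d r → K) where
  toFun x := StructDatum.blockEnd (matrixRep ρ x) (matrixRep (contragredient ρ) x)
    (matrixRep (contragredient σ) x)
  map_one' := by simp only [map_one, StructDatum.blockEnd_one]
  map_mul' x y := by simp only [map_mul, StructDatum.blockEnd_mul]

theorem structRep_apply (ρ : G →* Matrix (Fin d) (Fin d) K) (σ : G →* Matrix (Fin r) (Fin r) K)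
    (x : G) (z : StructIndex d r → K) : structRep ρ σ x z =
      structMk (unitPart z) ((ρ x).mulVec (mainPart z)) ((contragredient ρ x).mulVec (dualPart z))
        ((contragredient σ x).mulVec (formPart z)) (opPart z) := by
  simp only [← matrixRep_apply]
  rfl

theorem structRep_entry_mem (hinv : ∀ f ∈ R, (fun x : G => f x⁻¹) ∈ R)
    {ρ : G →* Matrix (Fin d) (Fin d) K} {σ : G →* Matrix (Fin r) (Fin r) K}
    (hρ : ∀ i j, (fun x => ρ x i j) ∈ R) (hσ : ∀ i j, (fun x => σ x i j) ∈ R)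
    (i j : StructIndex d r) : (fun x => structRep ρ σ x (Pi.single j 1) i) ∈ R := by
  simp only [structRep_apply]
  have hmv : ∀ {ι : Type} [Fintype ι] (τ : G → Matrix ι ι K), (∀ i j, (fun x => τ x i j) ∈ R) →
      ∀ (c : ι → k) (i : ι), (fun x => (τ x).mulVec (fun j => algebraMap k K (c j)) i) ∈ R := by
    intro ι _ τ hτ c i
    have : (fun x => (τ x).mulVec (fun j => algebraMap k K (c j)) i) =
        ∑ j, c j • fun x => τ x i j := by
      funext x
      simp [Matrix.mulVec, dotProduct, Finset.sum_apply, Algebra.smul_def, mul_comm]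
    rw [this]
    exact sum_mem fun j _ => Subalgebra.smul_mem _ (hτ i j) _
  have hconst : ∀ c : k, (fun _ : G => algebraMap k K c) ∈ R := fun c =>
    Subalgebra.algebraMap_mem R c
  have hsingle : (Pi.single j 1 : StructIndex d r → K) =
      fun i => algebraMap k K ((Pi.single j 1 : StructIndex d r → k) i) := by
    funext i
    by_cases hij : i = j
    · subst hij; simp
    · simp [hij]
  rw [hsingle]
  rcases i with i | i | i | i | i
  · exact hconst _
  · exact hmv (fun x => ρ x) hρ _ i
  · exact hmv (fun x => contragredient ρ x) (fun i j => hinv _ (hρ j i)) _ i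
  · exact hmv (fun x => contragredient σ x) (fun i j => hinv _ (hσ j i)) _ i
  · exact hconst _

/-- Since `b i x = ∑ j, b j 1 * ρ x j i` with `b j 1` in `k`, the block on `M` recovers `b i`; the
block on `M*` recovers `b i` composed with inversion. -/
theorem le_adjoin_structRep_entries (hR : IsLinearAlgebraicGroup k R)
    (h : FunctionDatum R D b w)
    (hgen : R ≤ Algebra.adjoin k (Set.range b ∪ Set.range fun i x => b i x⁻¹))
    {ρ : G →* Matrix (Fin d) (Fin d) K} (σ : G →* Matrix (Fin r) (Fin r) K)
    (hρ : ∀ i x y, b i (x * y) = ∑ j, b j x * ρ y j i) :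
    R ≤ Algebra.adjoin k {a | ∃ i j, a = fun x => structRep ρ σ x (Pi.single j 1) i} := by
  have h1 : ∀ i x, b i x = ∑ j, b j 1 * ρ x j i := fun i x => by rw [← hρ, one_mul]
  choose c hc using fun i => hR.one_rational _ (h.mem i)
  refine hgen.trans (Algebra.adjoin_le ?_)
  rintro _ (⟨i, rfl⟩ | ⟨i, rfl⟩)
  · have : b i = ∑ j, c j • fun x => structRep ρ σ x (Pi.single (Sum.inr (Sum.inl i)) 1)
        (Sum.inr (Sum.inl j)) := by
      funext x
      rw [h1, Finset.sum_apply]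
      refine Finset.sum_congr rfl fun j _ => ?_
      rw [hc, Pi.smul_apply, Algebra.smul_def, structRep_apply]
      have : mainPart (Pi.single (Sum.inr (Sum.inl i)) 1 : StructIndex d r → K) =
          Pi.single i 1 := by
        funext l
        by_cases hl : l = i <;> simp [mainPart, LinearMap.funLeft_apply, hl]
      rw [this]
      simp [structMk]
    rw [this]
    refine sum_mem fun j _ => Subalgebra.smul_mem _ (Algebra.subset_adjoin ?_) _
    exact ⟨_, _, rfl⟩
  · have : (fun x => b i x⁻¹) = ∑ j, c j • fun x => structRep ρ σ x
        (Pi.single (Sum.inr (Sum.inr (Sum.inl j))) 1) (Sum.inr (Sum.inr (Sum.inl i))) := by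
      funext x
      rw [h1, Finset.sum_apply]
      refine Finset.sum_congr rfl fun j _ => ?_
      rw [hc, Pi.smul_apply, Algebra.smul_def, structRep_apply]
      have : dualPart (Pi.single (Sum.inr (Sum.inr (Sum.inl j))) 1 : StructIndex d r → K) =
          Pi.single j 1 := by
        funext l
        by_cases hl : l = j <;> simp [dualPart, LinearMap.funLeft_apply, hl]
      rw [this]
      simp [structMk, contragredient_apply]
    simp only [this]
    refine sum_mem fun j _ => Subalgebra.smul_mem _ (Algebra.subset_adjoin ?_) _
    exact ⟨_, _, rfl⟩

/-- The automorphism group of the structure algebra is `G`, if every linear map on `M` that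
respects the structure comes from a right translation. -/
theorem range_structRep_eq_autGroup (h : FunctionDatum R D b w) (hD : D.Nondegenerate)
    {ρ : G →* Matrix (Fin d) (Fin d) K} {σ : G →* Matrix (Fin r) (Fin r) K}
    (hρ : ∀ i x y, b i (x * y) = ∑ j, b j x * ρ y j i)
    (hσ : ∀ i x y, w i (x * y) = ∑ j, w j x * σ y j i)
    (hpts : ∀ g : Module.End K (Fin d → K), Function.Injective g →
      g (D.map (algebraMap k K)).vec = (D.map (algebraMap k K)).vec →
      (∀ m c, g ((D.map (algebraMap k K)).act m c) = (D.map (algebraMap k K)).act (g m) c) →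
      (∀ m₁ m₂ m₃, Fintype.linearCombination K b m₁ * Fintype.linearCombination K b m₂ =
          Fintype.linearCombination K b m₃ → Fintype.linearCombination K b (g m₁) *
          Fintype.linearCombination K b (g m₂) = Fintype.linearCombination K b (g m₃)) →
      ∃ x, ∀ m y, Fintype.linearCombination K b (g m) y =
        Fintype.linearCombination K b m (y * x)) :
    (coordinateRep D.basis (structRep ρ σ)).range = autGroup k K D.Alg := by
  let DK := D.map (algebraMap k K)
  let e := D.coordBaseChange K
  have hDK : DK.Nondegenerate := hD.map _
  have hrep : ∀ x z, e (coordinateRep D.basis (structRep ρ σ) x z) = structRep ρ σ x (e z) :=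
    equivFun_coordinateRep D.basis (structRep ρ σ)
  have hmul : ∀ x z z', structRep ρ σ x (DK.mul z z') =
      DK.mul (structRep ρ σ x z) (structRep ρ σ x z') := by
    intro x z z'
    refine StructDatum.blockEnd_map_mul ?_ ?_ ?_ ?_ z z'
    · intro m m'
      rw [matrixRep_apply, matrixRep_apply, dotProduct_contragredient, inv_mulVec_mulVec]
    · intro m c
      rw [matrixRep_apply, matrixRep_apply, h.act_mulVec hρ]
    · intro m n
      rw [matrixRep_apply, matrixRep_apply, matrixRep_apply, h.form_mulVec hρ hσ]
    · rw [matrixRep_apply, h.mulVec_vec hρ]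
  ext g
  constructor
  · rintro ⟨x, rfl⟩ z z'
    apply e.injective
    rw [hrep, D.coordBaseChange_mul, D.coordBaseChange_mul, hrep, hrep, hmul]
  · intro hg
    have hg' : ∀ z z', g (z * z') = g z * g z' := hg
    let g₁ : (StructIndex d r → K) ≃ₗ[K] (StructIndex d r → K) := e.symm ≪≫ₗ g ≪≫ₗ e
    have hg₁ : ∀ z z', g₁ (DK.mul z z') = DK.mul (g₁ z) (g₁ z') := by
      intro z z'
      obtain ⟨z, rfl⟩ := e.surjective z
      obtain ⟨z', rfl⟩ := e.surjective z'
      rw [← D.coordBaseChange_mul]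
      simp only [g₁, LinearEquiv.trans_apply]
      rw [e.symm_apply_apply, e.symm_apply_apply, e.symm_apply_apply, hg',
        D.coordBaseChange_mul]
    -- The constant 1 lies in the span of `b`.
    have hd : 0 < d := by
      rcases Nat.eq_zero_or_pos d with rfl | hd
      · have := congrFun h.vec_eq 1
        simp at this
      · exact hd
    obtain ⟨x, hx⟩ := hpts (StructDatum.mainBlock g₁) (StructDatum.aut_main_injective hDK hg₁)
      (StructDatum.aut_vec hDK hg₁ hd) (StructDatum.aut_act hDK hg₁) (by
        intro m₁ m₂ m₃ hm
        -- Written as `m₁ m₂ = 1 · m₃`, the relation compares two products of pairs from `M`; `N`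
        -- detects these, and the vector of 1 is fixed.
        have hu : Fintype.linearCombination K b m₁ * Fintype.linearCombination K b m₂ =
            Fintype.linearCombination K b DK.vec * Fintype.linearCombination K b m₃ := by
          rw [h.lc_vec, one_mul, hm]
        rw [h.lc_mul, h.lc_mul] at hu
        have hu' := lc_injective h.prod_indep hu
        have h2 := StructDatum.aut_trilinear_congr hDK hg₁ (m₁ := m₁) (m₁' := m₂) (m₂ := DK.vec)
          (m₂' := m₃) (by
            intro n
            rw [D.dotProduct_form, D.dotProduct_form, hu'])
        rw [StructDatum.aut_vec hDK hg₁ hd] at h2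
        have h4 := dotProduct_eq _ _ fun n =>
          (D.dotProduct_form (StructDatum.mainBlock g₁ m₁) (StructDatum.mainBlock g₁ m₂) n).symm.trans
            ((h2 n).trans (D.dotProduct_form DK.vec (StructDatum.mainBlock g₁ m₃) n))
        rw [h.lc_mul, h4, ← h.lc_mul, h.lc_vec, one_mul])
    have hmain : ∀ m, StructDatum.mainBlock g₁ m = (ρ x).mulVec m := fun m =>
      lc_injective h.indep (funext fun y => by rw [hx, lc_translation hρ])
    -- The automorphism corrected by translation by `x⁻¹` is trivial on `M`, hence the identity.
    obtain ⟨g₂, hg₂⟩ : ∃ g₂ : (StructIndex d r → K) ≃ₗ[K] (StructIndex d r → K),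
        ∀ z, g₂ z = structRep ρ σ x⁻¹ (g₁ z) := by
      refine ⟨g₁ ≪≫ₗ (e.symm ≪≫ₗ coordinateRep D.basis (structRep ρ σ) x⁻¹ ≪≫ₗ e), fun z => ?_⟩
      rw [LinearEquiv.trans_apply, LinearEquiv.trans_apply, LinearEquiv.trans_apply, hrep,
        e.apply_symm_apply]
    have hid := StructDatum.aut_eq_refl hDK (g := g₂)
      (fun z z' => by rw [hg₂, hg₂, hg₂, hg₁, hmul]) (by
        intro m
        change mainPart (g₂ (structMk 0 m 0 0 0)) = m
        rw [hg₂, StructDatum.aut_main hDK hg₁, structRep_apply, hmain]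
        rw [mainPart_structMk, mainPart_structMk, inv_mulVec_mulVec])
    refine ⟨x, LinearEquiv.ext fun z => e.injective ?_⟩
    rw [hrep]
    have h5 := hid (e z)
    rw [hg₂] at h5
    have h6 : g₁ (e z) = e (g z) := by simp [g₁]
    rw [h6] at h5
    rw [← h5, ← Module.End.mul_apply, ← map_mul, mul_inv_cancel, map_one, Module.End.one_apply]

end Realization

/-! ### Choice of the weights, and assembly of the simple algebra. -/

section Existence

variable {k : Type*} [Field k] {K : Type*} [Field K] [Algebra k K] {G : Type*} [Group G]
  {R : Subalgebra k (G → K)}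

/-- An affine change of variable sends one of the `d + 5` chosen elements to 0, where it excludes
zero as a weight, and another to 1. -/
theorem exists_weights {k : Type*} [Field k] {d n : ℕ} (hn : d + 5 ≤ n)
    (hk : (n : Cardinal) ≤ Cardinal.mk k) : ∃ W : Fin 4 ⊕ Fin d → k,
      Function.Injective W ∧ W (Sum.inl 0) = 1 ∧ ∀ i, W i ≠ 0 := by
  obtain ⟨s, hs⟩ := Cardinal.exists_finset_eq_card hk
  have hcard : Fintype.card (Option (Fin 4 ⊕ Fin d)) ≤ Fintype.card s := by
    simp only [Fintype.card_option, Fintype.card_sum, Fintype.card_fin, Fintype.card_coe]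
    omega
  obtain ⟨f⟩ := Function.Embedding.nonempty_of_card_le hcard
  have hf : ∀ i j, (f i : k) = f j → i = j := fun i j h => f.injective (Subtype.ext h)
  have hne : ∀ i, (f (some i) : k) - f none ≠ 0 := fun i h =>
    Option.some_ne_none i (hf _ _ (sub_eq_zero.1 h))
  refine ⟨fun i => ((f (some i) : k) - f none) / (f (some (Sum.inl 0)) - f none), ?_, ?_, ?_⟩
  · intro i j h
    have h1 := (div_left_inj' (hne (Sum.inl 0))).1 h
    exact Option.some_injective _ (hf _ _ (sub_left_injective h1))
  · exact div_self (hne _)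
  · exact fun i => div_ne_zero (hne i) (hne _)

/-- The function datum of a finite-dimensional space of regular functions. -/
theorem exists_functionDatum (hR : IsAffineVariety k R) {M : Submodule k (G → K)} (hM : M.FG)
    (hMR : M ≤ R.toSubmodule) (h1 : (1 : G → K) ∈ M)
    (hcomul : M.map (comul k K G).toLinearMap ≤ boxProd M M)
    {W : Fin 4 ⊕ Fin (Module.finrank k M) → k} (hW : Function.Injective W)
    (hW1 : W (Sum.inl 0) = 1) (hW0 : ∀ i, W i ≠ 0) :
    ∃ (r : ℕ) (D : StructDatum k (Module.finrank k M) r) (b : Fin (Module.finrank k M) → G → K)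
      (w : Fin r → G → K), D.Nondegenerate ∧ FunctionDatum R D b w ∧
        Submodule.span k (Set.range b) = M := by
  obtain ⟨b, hb, hbM⟩ := exists_basis_family hM
  obtain ⟨w, hw, hwM⟩ := exists_basis_family (hM.mul hM)
  have hbmem : ∀ i, b i ∈ M := fun i => hbM.le (Submodule.subset_span ⟨i, rfl⟩)
  have hwmem : ∀ i, w i ∈ M * M := fun i => hwM.le (Submodule.subset_span ⟨i, rfl⟩)
  have hMMR : M * M ≤ R.toSubmodule := Submodule.mul_le.2 fun a ha c hc =>
    mul_mem (S := Subalgebra k (G → K)) (hMR ha) (hMR hc)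
  obtain ⟨vec, hvec⟩ := (Submodule.mem_span_range_iff_exists_fun k).1 (hbM.ge h1)
  have hop : ∀ i, ∃ c : Fin (Module.finrank k M) → Fin (Module.finrank k M) → k, ∀ x y,
      b i (x * y) = ∑ j, ∑ l, c j l • (b j x * b l y) := by
    intro i
    have h2 : comul k K G (b i) ∈ boxProd (Submodule.span k (Set.range b)) M := by
      rw [hbM]
      exact hcomul (Submodule.mem_map_of_mem (hbmem i))
    obtain ⟨c, hcM, hc⟩ := boxProd_span_left _ b h2
    choose t ht using fun j => (Submodule.mem_span_range_iff_exists_fun k).1 (hbM.ge (hcM j))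
    refine ⟨t, fun x y => (hc x y).trans (Finset.sum_congr rfl fun j _ => ?_)⟩
    rw [← ht, Finset.sum_apply, Finset.mul_sum]
    exact Finset.sum_congr rfl fun l _ => mul_smul_comm _ _ _
  choose op hop using hop
  choose pair hpair using fun i j => (Submodule.mem_span_range_iff_exists_fun k).1
    (hwM.ge (Submodule.mul_mem_mul (hbmem i) (hbmem j)))
  have hq : ∀ l, ∃ q : Fin (Module.finrank k M) → Fin (Module.finrank k M) → k,
      w l = ∑ i, ∑ j, q i j • (b i * b j) := by
    intro l
    have h2 : Submodule.span k (Set.range b) * Submodule.span k (Set.range b) ≤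
        Submodule.span k (Set.range fun p : _ × _ => b p.1 * b p.2) := by
      rw [Submodule.span_mul_span, Submodule.span_le]
      rintro _ ⟨_, ⟨i, rfl⟩, _, ⟨j, rfl⟩, rfl⟩
      exact Submodule.subset_span ⟨(i, j), rfl⟩
    obtain ⟨q, hq⟩ := (Submodule.mem_span_range_iff_exists_fun k).1
      (h2 (by rw [hbM]; exact hwmem l))
    refine ⟨fun i j => q (i, j), ?_⟩
    rw [← hq, Fintype.sum_prod_type]
  choose q hq using hq
  -- Substituting the expansions of `b i * b j` into that of `w l` and using independence of `w`.
  have hqpair : ∀ l l', ∑ i, ∑ j, q l i j * pair i j l' = if l = l' then 1 else 0 := by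
    intro l l'
    have h2 : ∑ l', (∑ i, ∑ j, q l i j * pair i j l' - if l = l' then 1 else 0) • w l' = 0 := by
      simp only [sub_smul, Finset.sum_sub_distrib, ite_smul, one_smul, zero_smul,
        Finset.sum_ite_eq, Finset.mem_univ, if_true]
      rw [sub_eq_zero]
      conv_rhs => rw [hq l]
      simp only [← hpair, Finset.smul_sum, Finset.sum_smul, smul_smul]
      rw [Finset.sum_comm]
      refine Finset.sum_congr rfl fun i _ => ?_
      rw [Finset.sum_comm]
    exact sub_eq_zero.1 (Fintype.linearIndependent_iff.1 hw _ h2 l')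
  refine ⟨_, ⟨W, fun i j => pair i j, fun j i => op i j, vec⟩, b, w,
    ⟨hW, hW1, hW0, q, hqpair⟩, ⟨fun i => hMR (hbmem i),
      linearIndependent_of_mem hR.linearIndep (fun i => hMR (hbmem i)) hb,
      linearIndependent_of_mem hR.linearIndep (fun i => hMMR (hwmem i)) hw, hvec, hop,
      fun i j => (hpair i j).symm, q, hq, hqpair⟩, hbM⟩

/-- A comodule of regular functions whose structure determines `G` yields a simple algebra with
automorphism group `G`. -/
theorem exists_simple_algebra {k : Type u} [Field k] {K : Type v} [Field K] [Algebra k K]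
    {G : Type w} [Group G] {R : Subalgebra k (G → K)} (hR : IsLinearAlgebraicGroup k R)
    {d r : ℕ} {D : StructDatum k d r} {b : Fin d → G → K} {w : Fin r → G → K}
    (h : FunctionDatum R D b w) (hD : D.Nondegenerate)
    (hgen : R ≤ Algebra.adjoin k (Set.range b ∪ Set.range fun i x => b i x⁻¹))
    (hpts : ∀ g : Module.End K (Fin d → K), Function.Injective g →
      g (D.map (algebraMap k K)).vec = (D.map (algebraMap k K)).vec →
      (∀ m c, g ((D.map (algebraMap k K)).act m c) = (D.map (algebraMap k K)).act (g m) c) →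
      (∀ m₁ m₂ m₃, Fintype.linearCombination K b m₁ * Fintype.linearCombination K b m₂ =
          Fintype.linearCombination K b m₃ → Fintype.linearCombination K b (g m₁) *
          Fintype.linearCombination K b (g m₂) = Fintype.linearCombination K b (g m₃)) →
      ∃ x, ∀ m y, Fintype.linearCombination K b (g m) y =
        Fintype.linearCombination K b m (y * x)) :
    ∃ (A : Type u) (_ : NonUnitalNonAssocRing A) (_ : Module k A)
      (_ : SMulCommClass k A A) (_ : IsScalarTower k A A),
      Module.Finite k A ∧ IsSimpleAlgebra k A ∧
      (∀ (F : Type x) [Field F] [Algebra k F], IsSimpleAlgebra F (F ⊗[k] A)) ∧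
      IsDefinedOver (glRegular k K A) (autGroup k K A : Set _) ∧
      IsKIsomorphic k R
        (restrictRegular (glRegular k K A) (autGroup k K A : Set _) :
          Subalgebra k (autGroup k K A → K)) := by
  obtain ⟨ρ, hρR, hρ⟩ := h.exists_mainRep
  obtain ⟨σ, hσR, hσ⟩ := h.exists_prodRep
  have h1 := coordinateRep_comp_mem hR.inv_regular D.basis (structRep ρ σ)
    (structRep_entry_mem hR.inv_regular hρR hσR)
  have h2 := exists_coordinateRep_comp_eq D.basis (structRep ρ σ)
    (le_adjoin_structRep_entries hR h hgen σ hρ)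
  have h3 := range_structRep_eq_autGroup h hD hρ hσ hpts
  refine ⟨D.Alg, inferInstance, inferInstance, inferInstance, inferInstance, inferInstance,
    StructDatum.isSimpleAlgebra hD, fun F _ _ => StructDatum.isSimpleAlgebra_baseChange hD F,
    ?_, isKIsomorphic_range hR.toIsAffineVariety _ h1 h2 _ h3⟩
  have h4 := isDefinedOver_range hR.toIsAffineVariety glRegular_separates _ h1 h2
  rwa [← MonoidHom.coe_range, h3] at h4

end Existence

/-! ### Functions of bounded degree on a matrix group. -/

section MatrixGroup

variable {k : Type*} [Field k] {K : Type*} [Field K] [Algebra k K]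
  {V : Type*} [AddCommGroup V] [Module k V] {G : Type*} [Group G] {R : Subalgebra k (G → K)}

theorem matrixCoeff_mul {J : Type*} [Fintype J] (B : Module.Basis J k V) (v : V)
    (l : Module.Dual k V) (g g' : (K ⊗[k] V) ≃ₗ[K] (K ⊗[k] V)) :
    matrixCoeff K v l (g * g') =
      ∑ p, matrixCoeff K (B p) l g * matrixCoeff K v (B.coord p) g' := by
  simp only [matrixCoeff, LinearEquiv.mul_apply]
  conv_lhs => rw [← (B.baseChange K).sum_equivFun (g' (1 ⊗ₜ[k] v))]
  rw [map_sum, map_sum]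
  refine Finset.sum_congr rfl fun p _ => ?_
  rw [map_smul, map_smul, Module.Basis.baseChange_apply, Module.Basis.equivFun_apply,
    baseChange_repr_eq, smul_eq_mul, mul_comm]

/-- The functions on `G` that are polynomials of degree at most `n` in the matrix coefficients. -/
def degreeLE (Ψ : G →* ((K ⊗[k] V) ≃ₗ[K] (K ⊗[k] V))) (n : ℕ) : Submodule k (G → K) :=
  (matrixCoeffs k K V ^ n).map (pullback k K Ψ).toLinearMap

theorem degreeLE_eq_pow (Ψ : G →* ((K ⊗[k] V) ≃ₗ[K] (K ⊗[k] V))) (n : ℕ) :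
    degreeLE Ψ n = degreeLE Ψ 1 ^ n := by
  rw [degreeLE, degreeLE, pow_one, Submodule.map_pow]

theorem one_mem_degreeLE (Ψ : G →* ((K ⊗[k] V) ≃ₗ[K] (K ⊗[k] V))) (n : ℕ) :
    1 ∈ degreeLE Ψ n :=
  ⟨1, mem_pow_of_le one_mem_matrixCoeffs (Nat.zero_le n) (by
    rw [pow_zero]; exact Submodule.one_le.1 le_rfl), rfl⟩

theorem degreeLE_mono (Ψ : G →* ((K ⊗[k] V) ≃ₗ[K] (K ⊗[k] V))) {n n' : ℕ} (h : n ≤ n') :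
    degreeLE Ψ n ≤ degreeLE Ψ n' :=
  Submodule.map_mono fun _ ha => mem_pow_of_le one_mem_matrixCoeffs h ha

theorem degreeLE_one_eq_span {J : Type*} [Fintype J] (B : Module.Basis J k V)
    (Ψ : G →* ((K ⊗[k] V) ≃ₗ[K] (K ⊗[k] V))) : degreeLE Ψ 1 = Submodule.span k
      (insert 1 (Set.range fun p : J × J => matrixCoeff K (B p.2) (B.coord p.1) ∘ Ψ)) := by
  rw [degreeLE, pow_one, matrixCoeffs_eq_span B, Submodule.map_span, Set.image_insert_eq,
    ← Set.range_comp]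
  rfl

theorem matrixCoeff_comp_mem_degreeLE (Ψ : G →* ((K ⊗[k] V) ≃ₗ[K] (K ⊗[k] V))) {n : ℕ} (hn : 1 ≤ n)
    (v : V) (l : Module.Dual k V) : matrixCoeff K v l ∘ Ψ ∈ degreeLE Ψ n :=
  degreeLE_mono Ψ hn ⟨_, by rw [pow_one]; exact matrixCoeff_mem_matrixCoeffs v l, rfl⟩

theorem degreeLE_fg [Module.Finite k V] (Ψ : G →* ((K ⊗[k] V) ≃ₗ[K] (K ⊗[k] V))) (n : ℕ) :
    (degreeLE Ψ n).FG := by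
  rw [degreeLE_eq_pow, degreeLE_one_eq_span (Module.finBasis k V)]
  exact (Submodule.fg_span ((Set.finite_range _).insert _)).pow n

-- Degree at most `n` means spanned by `n`-fold products from the set of 1 and the matrix entries.
open scoped Pointwise in
theorem finrank_degreeLE {J : Type*} [Fintype J] (B : Module.Basis J k V)
    (Ψ : G →* ((K ⊗[k] V) ≃ₗ[K] (K ⊗[k] V))) (n : ℕ) :
    Module.finrank k (degreeLE Ψ n) ≤ (Fintype.card J * Fintype.card J + 1) ^ n := by
  classical
  let S : Finset (G → K) :=
    insert 1 (Finset.univ.image fun p : J × J => matrixCoeff K (B p.2) (B.coord p.1) ∘ Ψ)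
  have hS : S.card ≤ Fintype.card J * Fintype.card J + 1 := by
    refine (Finset.card_insert_le _ _).trans (Nat.succ_le_succ (Finset.card_image_le.trans ?_))
    rw [Finset.card_univ, Fintype.card_prod]
  have h : degreeLE Ψ n = Submodule.span k ((S ^ n : Finset (G → K)) : Set (G → K)) := by
    rw [degreeLE_eq_pow, degreeLE_one_eq_span B, Submodule.span_pow, Finset.coe_pow]
    simp [S]
  rw [h]
  exact (finrank_span_finset_le_card _).trans (Finset.card_pow_le.trans (Nat.pow_le_pow_left hS n))

/-- In degree one this is matrix multiplication; higher degrees follow because the comultiplication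
is an algebra homomorphism. -/
theorem degreeLE_map_comul [Module.Finite k V] (Ψ : G →* ((K ⊗[k] V) ≃ₗ[K] (K ⊗[k] V))) (n : ℕ) :
    (degreeLE Ψ n).map (comul k K G).toLinearMap ≤ boxProd (degreeLE Ψ n) (degreeLE Ψ n) := by
  have h1 : (degreeLE Ψ 1).map (comul k K G).toLinearMap ≤
      boxProd (degreeLE Ψ 1) (degreeLE Ψ 1) := by
    let B := Module.finBasis k V
    conv_lhs => rw [degreeLE_one_eq_span B]
    rw [Submodule.map_span, Submodule.span_le]
    rintro _ ⟨f, rfl | ⟨p, rfl⟩, rfl⟩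
    · have := mul_mem_boxProd (one_mem_degreeLE Ψ 1) (one_mem_degreeLE Ψ 1)
      simp only [Pi.one_apply, mul_one] at this
      exact this
    · have : (comul k K G).toLinearMap (matrixCoeff K (B p.2) (B.coord p.1) ∘ Ψ) =
          ∑ q, fun z : G × G => (matrixCoeff K (B q) (B.coord p.1) ∘ Ψ) z.1 *
            (matrixCoeff K (B p.2) (B.coord q) ∘ Ψ) z.2 := by
        funext z
        rw [Finset.sum_apply]
        change matrixCoeff K _ _ (Ψ (z.1 * z.2)) = _
        rw [map_mul, matrixCoeff_mul B]
        rfl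
      rw [this]
      exact sum_mem fun q _ => mul_mem_boxProd (matrixCoeff_comp_mem_degreeLE Ψ le_rfl _ _)
        (matrixCoeff_comp_mem_degreeLE Ψ le_rfl _ _)
  rw [degreeLE_eq_pow, Submodule.map_pow, ← boxProd_pow]
  exact pow_le_pow_left' h1 n

/-- The functions `b i x⁻¹` are included to reach the inverse determinant. -/
theorem le_adjoin_of_degreeLE_le [Module.Finite k V] {Ψ : G →* ((K ⊗[k] V) ≃ₗ[K] (K ⊗[k] V))}
    (hΨ : ∀ f ∈ R, ∃ F ∈ glRegular k K V, F ∘ Ψ = f) {n : ℕ} (hn : 1 ≤ n)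
    {ι : Type*} {b : ι → G → K} (hb : degreeLE Ψ n ≤ Submodule.span k (Set.range b)) :
    R ≤ Algebra.adjoin k (Set.range b ∪ Set.range fun i x => b i x⁻¹) := by
  let S := Algebra.adjoin k (Set.range b ∪ Set.range fun i x => b i x⁻¹)
  have hinv : ∀ f ∈ S, (fun x : G => f x⁻¹) ∈ S := by
    intro f hf
    suffices h : S ≤ S.comap (pullback k K fun x : G => x⁻¹) from h hf
    refine Algebra.adjoin_le ?_
    rintro _ (⟨i, rfl⟩ | ⟨i, rfl⟩)
    · exact Algebra.subset_adjoin (Or.inr ⟨i, rfl⟩)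
    · refine Algebra.subset_adjoin (Or.inl ⟨i, ?_⟩)
      funext x
      simp
  have hspan : Submodule.span k (Set.range b) ≤ Subalgebra.toSubmodule S :=
    Submodule.span_le.2 fun f hf => Algebra.subset_adjoin (Or.inl hf)
  intro f hf
  obtain ⟨F, hF, rfl⟩ := hΨ f hf
  exact glRegular_comp_mem hinv Ψ
    (fun v l => hspan (hb (matrixCoeff_comp_mem_degreeLE Ψ hn v l))) F hF

end MatrixGroup

/-! ### Recovering a group element from a structure-preserving map. -/

section Points

theorem exists_lc_eq {k : Type*} [Field k] {K : Type*} [Field K] [Algebra k K] {X ι : Type*}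
    [Fintype ι] {b : ι → X → K} {f : X → K} (hf : f ∈ Submodule.span k (Set.range b)) :
    ∃ m, Fintype.linearCombination K b m = f := by
  obtain ⟨c, rfl⟩ := (Submodule.mem_span_range_iff_exists_fun k).1 hf
  refine ⟨fun i => algebraMap k K (c i), ?_⟩
  rw [Fintype.linearCombination_apply]
  exact Finset.sum_congr rfl fun i _ => algebraMap_smul K _ _

variable {k : Type*} [Field k] {K : Type*} [Field K] [Algebra k K] {V : Type*} [AddCommGroup V]
  [Module k V] {G : Type*} [Group G] {R : Subalgebra k (G → K)} {d r n : ℕ}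
  {D : StructDatum k d r} {b : Fin d → G → K} {w : Fin r → G → K}
  {Ψ : G →* ((K ⊗[k] V) ≃ₗ[K] (K ⊗[k] V))}

/-- A linear map that commutes with left translations maps each row of matrix coefficients by an
invertible matrix. -/
theorem exists_matrix_of_commute {J : Type*} [Fintype J] (h : FunctionDatum R D b w)
    (B : Module.Basis J k V) {ξ : J → J → Fin d → K}
    (hξ : ∀ i j, Fintype.linearCombination K b (ξ i j) = matrixCoeff K (B j) (B.coord i) ∘ Ψ)
    {g : Module.End K (Fin d → K)} (hginj : Function.Injective g)
    (hact : ∀ m c, g ((D.map (algebraMap k K)).act m c) =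
      (D.map (algebraMap k K)).act (g m) c) :
    ∃ γ : (K ⊗[k] V) ≃ₗ[K] (K ⊗[k] V), ∀ i j, matrixCoeff K (B j) (B.coord i) γ =
      Fintype.linearCombination K b (g (ξ i j)) 1 := by
  classical
  let Γ : Matrix J J K := Matrix.of fun i j => Fintype.linearCombination K b (g (ξ i j)) 1
  -- The comultiplication of matrix coefficients, written in coordinates.
  have h1 : ∀ i j c, (D.map (algebraMap k K)).act (ξ i j) (Pi.single c 1) =
      ∑ l, ξ i l c • ξ l j := by
    intro i j c
    refine lc_injective h.indep ?_
    refine congrFun (h.eq_of_sum_eq (v := fun c => Fintype.linearCombination K b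
      ((D.map (algebraMap k K)).act (ξ i j) (Pi.single c 1)))
      (v' := fun c => Fintype.linearCombination K b (∑ l, ξ i l c • ξ l j)) fun x y => ?_) c
    rw [← h.lc_comul, hξ, Function.comp_apply, map_mul, matrixCoeff_mul B]
    simp only [map_sum, map_smul, Finset.sum_apply, Pi.smul_apply, hξ, Finset.mul_sum]
    rw [Finset.sum_comm]
    refine Finset.sum_congr rfl fun l _ => ?_
    have h2 := congrFun (hξ i l) x
    rw [lc_apply, Function.comp_apply] at h2
    rw [← h2, Finset.sum_mul]
    refine Finset.sum_congr rfl fun c _ => ?_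
    simp only [Function.comp_apply, smul_eq_mul]
    ring
  have h2 : ∀ i j x, Fintype.linearCombination K b (g (ξ i j)) x =
      ∑ l, matrixCoeff K (B l) (B.coord i) (Ψ x) * Γ l j := by
    intro i j x
    have h3 := h.lc_comul (g (ξ i j)) x 1
    rw [mul_one] at h3
    rw [h3]
    simp only [← hact, h1, map_sum, map_smul, Finset.sum_apply, Pi.smul_apply, Finset.mul_sum]
    rw [Finset.sum_comm]
    refine Finset.sum_congr rfl fun l _ => ?_
    have h2 := congrFun (hξ i l) x
    rw [lc_apply, Function.comp_apply] at h2
    rw [← h2, Finset.sum_mul]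
    refine Finset.sum_congr rfl fun c _ => ?_
    simp only [smul_eq_mul, Γ, Matrix.of_apply]
    ring
  -- If `Γ v = 0`, then `g` kills the combination with coefficients `v` of each row of matrix
  -- coefficients. By injectivity these combinations vanish on `G`, and at the identity they give
  -- the coordinates of `v`.
  have hΓ : IsUnit Γ := by
    rw [← Matrix.mulVec_injective_iff_isUnit]
    refine (injective_iff_map_eq_zero Γ.mulVecLin).2 fun v hv => ?_
    have hv' : ∀ l, ∑ j, Γ l j * v j = 0 := fun l => congrFun hv l
    have h3 : ∀ i, ∑ j, v j • ξ i j = 0 := by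
      intro i
      refine hginj (lc_injective h.indep ?_)
      funext x
      simp only [map_sum, map_smul, Finset.sum_apply, Pi.smul_apply, h2, map_zero, Pi.zero_apply,
        smul_eq_mul, Finset.mul_sum]
      rw [Finset.sum_comm]
      refine Finset.sum_eq_zero fun l _ => ?_
      rw [← mul_zero (matrixCoeff K (B l) (B.coord i) (Ψ x)), ← hv' l, Finset.mul_sum]
      exact Finset.sum_congr rfl fun j _ => by ring
    funext i
    have h4 := congrFun (congrArg (Fintype.linearCombination K b) (h3 i)) 1
    simp only [map_sum, map_smul, Finset.sum_apply, Pi.smul_apply, hξ, map_zero, Pi.zero_apply,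
      smul_eq_mul, Function.comp_apply, map_one] at h4
    have h5 : ∀ j, matrixCoeff K (B j) (B.coord i) 1 = if j = i then 1 else 0 := by
      intro j
      change Module.Dual.baseChange K (B.coord i) (1 ⊗ₜ[k] B j) = _
      rw [← baseChange_repr_eq, ← Module.Basis.baseChange_apply, Module.Basis.repr_self,
        Finsupp.single_apply]
    simpa [h5] using h4
  have hdet : IsUnit Γ.det := (Matrix.isUnit_iff_isUnit_det Γ).1 hΓ
  refine ⟨Matrix.toLinearEquiv (B.baseChange K) Γ hdet, fun i j => ?_⟩
  rw [matrixCoeff, ← baseChange_repr_eq, ← Module.Basis.baseChange_apply]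
  change (B.baseChange K).repr (Matrix.toLin (B.baseChange K) (B.baseChange K) Γ _) i = _
  rw [Matrix.toLin_self]
  simp [Γ, Finsupp.single_apply]

/-- A linear map on the functions of degree at most `n` that respects the structure is a right
translation, if `G` is defined by equations of degree at most `n`. -/
theorem exists_translation [Module.Finite k V] (h : FunctionDatum R D b w) (hn : 1 ≤ n)
    (hb : Submodule.span k (Set.range b) = degreeLE Ψ n)
    (hΨ : IsDefinedInDegree k K V n (Set.range Ψ)) {g : Module.End K (Fin d → K)}
    (hginj : Function.Injective g)
    (hvec : g (D.map (algebraMap k K)).vec = (D.map (algebraMap k K)).vec)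
    (hact : ∀ m c, g ((D.map (algebraMap k K)).act m c) =
      (D.map (algebraMap k K)).act (g m) c)
    (hmul : ∀ m₁ m₂ m₃, Fintype.linearCombination K b m₁ * Fintype.linearCombination K b m₂ =
      Fintype.linearCombination K b m₃ → Fintype.linearCombination K b (g m₁) *
        Fintype.linearCombination K b (g m₂) = Fintype.linearCombination K b (g m₃)) :
    ∃ x, ∀ m y, Fintype.linearCombination K b (g m) y =
      Fintype.linearCombination K b m (y * x) := by
  let B := Module.finBasis k V
  have hlc : ∀ f ∈ degreeLE Ψ n, ∃ m, Fintype.linearCombination K b m = f := fun f hf =>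
    exists_lc_eq (hb.ge hf)
  choose ξ hξ using fun i j => hlc _ (matrixCoeff_comp_mem_degreeLE Ψ hn (B j) (B.coord i))
  obtain ⟨γ, hγ⟩ := exists_matrix_of_commute h B hξ hginj hact
  -- On the polynomials satisfying `C`, the functional `f ↦ g(f)(1)` agrees with evaluation at `γ`.
  let C : (((K ⊗[k] V) ≃ₗ[K] (K ⊗[k] V)) → K) → Prop := fun F =>
    ∃ m, Fintype.linearCombination K b m = F ∘ Ψ ∧ Fintype.linearCombination K b (g m) 1 = F γ
  have hC1 : C 1 := ⟨(D.map (algebraMap k K)).vec, h.lc_vec, by rw [hvec, h.lc_vec]; rfl⟩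
  have hCsmul : ∀ (c : k) F, C F → C (c • F) := by
    rintro c F ⟨m, hm, hm'⟩
    refine ⟨algebraMap k K c • m, ?_, ?_⟩
    · rw [map_smul, hm, algebraMap_smul]; rfl
    · rw [map_smul, map_smul, Pi.smul_apply, hm', algebraMap_smul]; rfl
  have hCadd : ∀ F F', C F → C F' → C (F + F') := by
    rintro F F' ⟨m, hm, hm'⟩ ⟨l, hl, hl'⟩
    refine ⟨m + l, ?_, ?_⟩
    · rw [map_add, hm, hl]; rfl
    · rw [map_add, map_add, Pi.add_apply, hm', hl']; rfl
  have hCcoeff : ∀ F ∈ matrixCoeffs k K V, C F := by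
    intro F hF
    rw [matrixCoeffs_eq_span B] at hF
    induction hF using Submodule.span_induction with
    | mem F hF =>
      rcases hF with rfl | ⟨p, rfl⟩
      · exact hC1
      · exact ⟨ξ p.1 p.2, hξ _ _, (hγ _ _).symm⟩
    | zero => simpa using hCsmul 0 1 hC1
    | add F F' _ _ hF hF' => exact hCadd F F' hF hF'
    | smul c F _ hF => exact hCsmul c F hF
  -- All partial products have degree at most `n`, so each multiplication is a relation inside `M`,
  -- to which `hmul` applies.
  have hC : ∀ i ≤ n, ∀ F ∈ matrixCoeffs k K V ^ i, C F := by
    intro i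
    induction i with
    | zero =>
      intro _ F hF
      rw [pow_zero] at hF
      obtain ⟨c, rfl⟩ := Submodule.mem_one.1 hF
      rw [Algebra.algebraMap_eq_smul_one]
      exact hCsmul c 1 hC1
    | succ i ih =>
      intro hi F hF
      rw [pow_succ] at hF
      refine Submodule.mul_induction_on hF ?_ hCadd
      intro F hF a ha
      obtain ⟨m, hm, hm'⟩ := ih (Nat.le_of_succ_le hi) F hF
      obtain ⟨l, hl, hl'⟩ := hCcoeff a ha
      obtain ⟨p, hp⟩ := hlc ((F * a) ∘ Ψ) ⟨F * a, mem_pow_of_le one_mem_matrixCoeffs hi (by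
        rw [pow_succ]; exact Submodule.mul_mem_mul hF ha), rfl⟩
      have h1 := hmul m l p (by rw [hm, hl, hp]; rfl)
      refine ⟨p, hp, ?_⟩
      rw [← h1, Pi.mul_apply, hm', hl']
      rfl
  -- A defining equation of degree at most `n` restricts to 0 on `G`, so its coordinate vector is 0,
  -- and by `C` it vanishes at `γ`.
  have hγΨ : γ ∈ Set.range Ψ := by
    refine hΨ.1 γ fun f hf => ?_
    rw [hΨ.2] at hf
    let ev : regularFunctions (glRegular k K V) →+* K :=
      (Pi.evalRingHom (fun _ => K) γ).comp (regularFunctions (glRegular k K V)).val.toRingHom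
    suffices h1 : Ideal.span {f | f ∈ vanishingIdeal (glRegular k K V) (Set.range Ψ) ∧
        (f : ((K ⊗[k] V) ≃ₗ[K] (K ⊗[k] V)) → K) ∈ matrixCoeffs k K V ^ n} ≤ RingHom.ker ev from
      h1 hf
    refine Ideal.span_le.2 ?_
    rintro F ⟨hF0, hF⟩
    obtain ⟨m, hm, hm'⟩ := hC n le_rfl _ hF
    have h2 : Fintype.linearCombination K b m = 0 := by
      rw [hm]
      exact funext fun x => hF0 _ ⟨x, rfl⟩
    have h3 : m = 0 := lc_injective h.indep (by rw [h2, map_zero])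
    rw [h3, map_zero, map_zero] at hm'
    exact hm'.symm
  obtain ⟨x, rfl⟩ := hγΨ
  have heval : ∀ m, Fintype.linearCombination K b (g m) 1 = Fintype.linearCombination K b m x := by
    have h1 : (LinearMap.proj 1 : (G → K) →ₗ[K] K) ∘ₗ Fintype.linearCombination K b ∘ₗ g =
        (LinearMap.proj x : (G → K) →ₗ[K] K) ∘ₗ Fintype.linearCombination K b := by
      refine (Pi.basisFun K (Fin d)).ext fun i => ?_
      obtain ⟨F, hF, hFb⟩ := hb.le (Submodule.subset_span ⟨i, rfl⟩)
      obtain ⟨m, hm, hm'⟩ := hC n le_rfl F hF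
      have h2 : Fintype.linearCombination K b (Pi.single i 1) = F ∘ Ψ := by
        rw [Fintype.linearCombination_apply_single, one_smul]
        exact hFb.symm
      have h3 : m = Pi.single i 1 := lc_injective h.indep (by rw [hm, h2])
      rw [h3] at hm'
      simp only [Pi.basisFun_apply, LinearMap.comp_apply, LinearMap.proj_apply, hm', h2]
      rfl
    exact fun m => LinearMap.congr_fun h1 m
  refine ⟨x, fun m y => ?_⟩
  -- Left equivariance reduces equality at `y` to equality at the identity, which is `heval`.
  have h1 := h.lc_comul (g m) y 1
  rw [mul_one] at h1
  rw [h1, h.lc_comul]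
  exact Finset.sum_congr rfl fun j _ => by rw [← hact, heval]

end Points

theorem pow_le_toSubmodule {k X K : Type*} [Field k] [Field K] [Algebra k K]
    {M : Submodule k (X → K)} {S : Subalgebra k (X → K)} (h : M ≤ Subalgebra.toSubmodule S) (n : ℕ) :
    M ^ n ≤ Subalgebra.toSubmodule S := by
  induction n with
  | zero =>
    rw [pow_zero, Submodule.one_le]
    exact one_mem S
  | succ n ih =>
    rw [pow_succ, Submodule.mul_le]
    exact fun a ha c hc => mul_mem (S := Subalgebra k (X → K)) (ih ha) (h hc)

theorem HasLinearRealization.exists_simple_algebra {k : Type u} [Field k] {K : Type v} [Field K]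
    [Algebra k K] {G : Type w} [Group G] {R : Subalgebra k (G → K)}
    (hR : IsLinearAlgebraicGroup k R) {m h : ℕ} (hG : HasLinearRealization k R m h)
    (hk : (((m * m + 1) ^ max h 1 + 5 : ℕ) : Cardinal) ≤ Cardinal.mk k) :
    ∃ (A : Type u) (_ : NonUnitalNonAssocRing A) (_ : Module k A)
      (_ : SMulCommClass k A A) (_ : IsScalarTower k A A),
      Module.Finite k A ∧ IsSimpleAlgebra k A ∧
      (∀ (F : Type x) [Field F] [Algebra k F], IsSimpleAlgebra F (F ⊗[k] A)) ∧
      IsDefinedOver (glRegular k K A) (autGroup k K A : Set _) ∧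
      IsKIsomorphic k R
        (restrictRegular (glRegular k K A) (autGroup k K A : Set _) :
          Subalgebra k (autGroup k K A → K)) := by
  obtain ⟨H, hH, φ, hφ⟩ := hG
  -- Degree at least one ensures that `M` contains the matrix coefficients.
  let n := max h 1
  have hn : 1 ≤ n := le_max_right _ _
  let Ψ : G →* ((K ⊗[k] (Fin m → k)) ≃ₗ[K] (K ⊗[k] (Fin m → k))) :=
    H.subtype.comp φ.toMonoidHom
  have hrange : Set.range Ψ = H := by
    ext g
    constructor
    · rintro ⟨x, rfl⟩
      exact (φ x).2
    · intro hg
      exact ⟨φ.symm ⟨g, hg⟩, congrArg Subtype.val (φ.apply_symm_apply ⟨g, hg⟩)⟩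
  have hΨmem : ∀ F ∈ glRegular k K (Fin m → k), F ∘ Ψ ∈ R := fun F hF =>
    (hφ _).1 ⟨F, hF, rfl⟩
  have hΨ : ∀ f ∈ R, ∃ F ∈ glRegular k K (Fin m → k), F ∘ Ψ = f := by
    intro f hf
    obtain ⟨F, hF, hFf⟩ := (hφ fun y => f (φ.symm y)).2 (by simpa using hf)
    refine ⟨F, hF, funext fun x => ?_⟩
    have := congrFun hFf (φ x)
    simp only [MulEquiv.symm_apply_apply] at this
    exact this
  have hdeg : IsDefinedInDegree k K (Fin m → k) n (Set.range Ψ) := by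
    rw [hrange]
    exact hH.mono (le_max_left _ _)
  have hmcgl : matrixCoeffs k K (Fin m → k) ≤
      Subalgebra.toSubmodule (glRegular k K (Fin m → k)) := fun F hF =>
    Algebra.subset_adjoin (Or.inl hF)
  have hMR : degreeLE Ψ n ≤ R.toSubmodule := by
    rintro _ ⟨F, hF, rfl⟩
    exact hΨmem F (pow_le_toSubmodule hmcgl n hF)
  have hfin := finrank_degreeLE (Pi.basisFun k (Fin m)) Ψ n
  rw [Fintype.card_fin] at hfin
  obtain ⟨W, hW, hW1, hW0⟩ := exists_weights (Nat.add_le_add_right hfin 5) hk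
  obtain ⟨r, D, b, w, hD, hFD, hb⟩ := exists_functionDatum hR.toIsAffineVariety (degreeLE_fg Ψ n)
    hMR (one_mem_degreeLE Ψ n) (degreeLE_map_comul Ψ n) hW hW1 hW0
  exact _root_.exists_simple_algebra hR hFD hD (le_adjoin_of_degreeLE_le hΨ hn hb.ge)
    fun g h1 h2 h3 h4 => exists_translation hFD hn hb hdeg h1 h2 h3 h4

theorem theorem1 :
    ∃ N : ℕ → ℕ → ℕ,
      ∀ (k : Type u) [Field k] (K : Type v) [Field K] [Algebra k K] [IsAlgClosed K]
        (G : Type w) [Group G] (R : Subalgebra k (G → K)),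
        IsLinearAlgebraicGroup k R →
        (∃ m h : ℕ, HasLinearRealization k R m h) ∧
        ((Infinite k ∨
            ∃ m h : ℕ, HasLinearRealization k R m h ∧ (N m h : Cardinal) ≤ Cardinal.mk k) →
          ∃ (A : Type u) (_ : NonUnitalNonAssocRing A) (_ : Module k A)
            (_ : SMulCommClass k A A) (_ : IsScalarTower k A A),
            Module.Finite k A ∧
            IsSimpleAlgebra k A ∧
            (∀ (F : Type x) [Field F] [Algebra k F], IsSimpleAlgebra F (F ⊗[k] A)) ∧
            IsDefinedOver (glRegular k K A) (autGroup k K A : Set _) ∧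
            IsKIsomorphic k R
              (restrictRegular (glRegular k K A) (autGroup k K A : Set _) :
                Subalgebra k (autGroup k K A → K))) := by
  -- The power bounds `dim M`; the summand 5 accounts for the weights of `e`, `M`, `M*`, `N` and for
  -- the excluded value 0.
  refine ⟨fun m h => (m * m + 1) ^ max h 1 + 5, fun k _ K _ _ _ G _ R hR => ?_⟩
  refine ⟨hR.exists_hasLinearRealization, ?_⟩
  rintro (hk | ⟨m, h, hG, hk⟩)
  · obtain ⟨m, h, hG⟩ := hR.exists_hasLinearRealization
    exact hG.exists_simple_algebra hR
      (Cardinal.natCast_lt_aleph0.le.trans (Cardinal.aleph0_le_mk k))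
  · exact hG.exists_simple_algebra hR hk
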